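/- **Setting.** Let $\mathcal C, S, A$ be finite sets and $H\ge 1$. A stochastic contextual MDP consists of a context distribution $\mathcal D$ on $\mathcal C$, a partition of $S$ into layers $S_1=\{s_1\},S_2,\dots,S_H,S_{H+1}=\{s_{H+1}\}$, transition functions $P^\star_c(\cdot\mid s,a)\in\Delta_S$ that from a state of $S_h$ ($h\le H$) only reach $S_{h+1}$, and, for all $(c,s,a)$, a loss distribution on $[0,1]$ with mean $\ell^\star_c(s,a)$. Let $\mathcal F$ be a finite class of functions $\mathcal C\times S\times A\to[0,1]$ with $\ell^\star\in\mathcal F$, and $\mathcal P$ a finite class of transition functions $\mathcal C\times S\times A\to\Delta_S$ that respect the layers, with $P^\star\in\mathcal P$. For a policy $\pi:S\to\Delta_A$ and dynamics $P$, let $q_h(s,a\mid\pi,P)$ be the probability that $(s_h,a_h)=(s,a)$ when starting at $s_1$; $\mathbb E_{\pi,P}$ is the corresponding expectation. Let $\pi^\star$ be an optimal context-dependent policy: for every $c$, $\pi^\star_c$ minimises $\mathbb E_{\pi,P^\star_c}[\sum_{h=1}^H\ell^\star_c(s_h,a_h)]$ over all policies $\pi:S\to\Delta_A$. **Algorithm.**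 Fix $T\ge1$, $\eta\in\mathbb R$ and $\beta_\ell,\beta_P>0$. In round $t=1,\dots,T$ a context $c_t\sim\mathcal D$ is drawn independently of the past, the policy $\pi^t_{c_t}$ is played in the MDP of $c_t$, and the trajectory $(c_t,s^t_1,a^t_1,\ell^t_1,\dots,s^t_{H+1})$ is observed, where each loss $\ell^t_h$ is drawn independently from the loss distribution of $(c_t,s^t_h,a^t_h)$. For each $t$, let $$\hat f^t\in\arg\min_{f\in\mathcal F}\sum_{i<t}\sum_{h=1}^H\big(f_{c_i}(s^i_h,a^i_h)-\ell^i_h\big)^2,\qquad \hat P^t\in\arg\max_{P\in\mathcal P}\sum_{i<t}\sum_{h=1}^H\log P_{c_i}(s^i_{h+1}\mid s^i_h,a^i_h),$$ with $\log 0=-\infty$ and ties broken deterministically (and measurably), as a function of the first $t-1$ trajectories. For $s\in S_h$ let $$b^t_\beta(c,s,a)=\min\Big\{1,\frac{\beta/2}{1+\sum_{i=1}^{t-1}q_h(s,a\mid\pi^i_c,\hat P^t_c)}\Big\},\qquad \hat\ell^t_c=\hat f^t_c-b^t_{\beta_\ell}(c,\cdot,\cdot)-2H\,b^t_{\beta_P}(c,\cdot,\cdot),$$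 and let $\hat V^t_{c,H+1}=0$ and, for $h=H,\dots,1$, $\hat Q^t_{c,h}(s,a)=\max\{0,\hat\ell^t_c(s,a)+\sum_{s'}\hat P^t_c(s'\mid s,a)\hat V^t_{c,h+1}(s')\}$, $\hat V^t_{c,h}(s)=\sum_a\pi^t_c(a\mid s)\hat Q^t_{c,h}(s,a)$. The policies are: $\pi^1$ is uniform, and $\pi^{t+1}_c(a\mid s)\propto\pi^t_c(a\mid s)\exp(-\eta\hat Q^t_{c,h}(s,a))$ for $s\in S_h$. **Claim.** For every $\delta\in(0,1)$, with probability at least $1-\delta/4$ over the $T$ episodes, the optimism term $$(iv)=\sum_{t=1}^T\mathbb E_{c\sim\mathcal D}\Big[\sum_{h=1}^H\mathbb E_{\pi^\star_c,P^\star_c}\Big[\hat Q^t_{c,h}(s_h,a_h)-\ell^\star_c(s_h,a_h)-\sum_{s'}P^\star_c(s'\mid s_h,a_h)\hat V^t_{c,h+1}(s')\Big]\Big]$$ satisfies $$(iv)\le H(H+1)+\frac{112\,TH^3\log\!\big(128\,T^4H|\mathcal F||\mathcal P|/\delta^2\big)}{\beta_\ell}+\frac{25\,TH^4\log\!\big(8\,TH|\mathcal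 P|/\delta\big)}{\beta_P}.$$ -/

import Mathlib

open MeasureTheory

/-! Layered contextual MDPs with finite context, state and action spaces.  Layers, steps and
rounds are numbered from `0`: the layers are `0, …, H`, the steps of an episode are
`0, …, H - 1`, and at round `t` exactly `t` episodes have been completed. -/

noncomputable section

namespace OPO

/-- `P` assigns to every context, state and action a probability distribution over next states,
and from every state of a non-final layer it only moves to the next layer. -/
def IsLayeredDynamics {C S A : Type*} [Fintype S] (H : ℕ) (layer : S → ℕ)
    (P : C → S → A → S → ℝ) : Prop :=
  (∀ c s a, P c s a ∈ stdSimplex ℝ S) ∧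
    ∀ c s a s', layer s < H → P c s a s' ≠ 0 → layer s' = layer s + 1

/-- A stochastic contextual MDP with horizon `H`: contexts are drawn from `ctx`; in context `c` the
transition function is `trans c` and the observed loss of `(s, a)` has law `lossLaw c s a`.
All contexts share the same layers, with unique start and end states. -/
structure CMDP (C S A : Type*) [Fintype C] [Fintype S] (H : ℕ) where
  ctx : C → ℝ
  ctx_mem : ctx ∈ stdSimplex ℝ C
  start : S
  final : S
  layer : S → ℕ
  layer_le : ∀ s, layer s ≤ H
  layer_start : ∀ s, layer s = 0 ↔ s = start
  layer_final : ∀ s, layer s = H ↔ s = final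
  trans : C → S → A → S → ℝ
  trans_layered : IsLayeredDynamics H layer trans
  lossLaw : C → S → A → Measure ℝ
  lossLaw_prob : ∀ c s a, IsProbabilityMeasure (lossLaw c s a)
  lossLaw_supp : ∀ c s a, lossLaw c s a (Set.Icc 0 1)ᶜ = 0

/-- One step of a trajectory: state, action, observed loss, next state. -/
abbrev Step (S A : Type*) := S × A × ℝ × S

/-- An observed episode: the context together with the `H` steps of the trajectory. -/
abbrev Episode (C S A : Type*) (H : ℕ) := C × (Fin H → Step S A)

/-- Stationary policies: `π s a` is the probability of action `a` in state `s`. -/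
def IsPolicy {S A : Type*} [Fintype A] (π : S → A → ℝ) : Prop :=
  ∀ s, π s ∈ stdSimplex ℝ A

section Model

variable {S A : Type*} [Fintype S] [Fintype A]

/-- `stateProb s₁ π P h s` is the probability of being in state `s` at step `h`. -/
def stateProb [DecidableEq S] (s₁ : S) (π : S → A → ℝ) (P : S → A → S → ℝ) : ℕ → S → ℝ
  | 0 => fun s => if s = s₁ then 1 else 0
  | h + 1 => fun s' => ∑ s, ∑ a, stateProb s₁ π P h s * π s a * P s a s'

/-- The occupancy measure `q_h(s, a | π, P)`. -/
def occ [DecidableEq S] (s₁ : S) (π : S → A → ℝ) (P : S → A → S → ℝ) (h : ℕ) (s : S) (a : A) : ℝ :=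
  stateProb s₁ π P h s * π s a

/-- `E_{π, P} [g (s_h, a_h) | s₁]`. -/
def expect [DecidableEq S] (s₁ : S) (π : S → A → ℝ) (P : S → A → S → ℝ) (h : ℕ)
    (g : S → A → ℝ) : ℝ :=
  ∑ s, ∑ a, occ s₁ π P h s a * g s a

/-- The value `E_{π, P} [∑_h ℓ (s_h, a_h) | s₁]` of a policy over `H` steps. -/
def value [DecidableEq S] (H : ℕ) (s₁ : S) (P : S → A → S → ℝ) (ℓ : S → A → ℝ)
    (π : S → A → ℝ) : ℝ :=
  ∑ h ∈ Finset.range H, expect s₁ π P h ℓ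

/-- The law of the next `n` steps of a trajectory that starts in `s`: draw `a ∼ π(· | s)`, then
independently the loss from `L s a` and the next state `s' ∼ P(· | s, a)`, and continue. -/
def rollout [MeasurableSpace S] [MeasurableSpace A] (π : S → A → ℝ) (P : S → A → S → ℝ)
    (L : S → A → Measure ℝ) : (n : ℕ) → S → Measure (Fin n → Step S A)
  | 0 => fun _ => Measure.dirac Fin.elim0
  | n + 1 => fun s => ∑ a, ∑ s', ENNReal.ofReal (π s a * P s a s') •
      ((L s a).prod (rollout π P L n s')).map
        (fun x => (Fin.cons (s, a, x.1, s') x.2 : Fin (n + 1) → Step S A))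

/-- `qRem lhat P π n` is the estimated `Q`-function with `n` steps to go: it is `0` for `n = 0`,
and then `max {0, lhat + P V}`, where `V s = ⟨π(· | s), Q(s, ·)⟩`. -/
def qRem (lhat : S → A → ℝ) (P : S → A → S → ℝ) (π : S → A → ℝ) : ℕ → S → A → ℝ
  | 0 => fun _ _ => 0
  | n + 1 => fun s a =>
      max 0 (lhat s a + ∑ s', P s a s' * ∑ a', π s' a' * qRem lhat P π n s' a')

/-- The exponential weights update of a policy. -/
def expWeights (η : ℝ) (π Q : S → A → ℝ) (s : S) (a : A) : ℝ :=
  π s a * Real.exp (-η * Q s a) / ∑ a', π s a' * Real.exp (-η * Q s a')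

end Model

variable {C S A : Type*} [Fintype C] [Fintype S] [Fintype A] {H : ℕ}

/-- The expected loss `ℓ⋆`. -/
def CMDP.meanLoss (M : CMDP C S A H) (c : C) (s : S) (a : A) : ℝ :=
  ∫ x, x ∂(M.lossLaw c s a)

/-- `π` is an optimal context-dependent policy. -/
def CMDP.IsOptimal [DecidableEq S] (M : CMDP C S A H) (π : C → S → A → ℝ) : Prop :=
  ∀ c, IsPolicy (π c) ∧ ∀ π' : S → A → ℝ, IsPolicy π' →
    value H M.start (M.trans c) (M.meanLoss c) (π c) ≤
      value H M.start (M.trans c) (M.meanLoss c) π'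

/-- The law of one episode in which the context-dependent policy `π` is played. -/
def CMDP.episodeLaw [MeasurableSpace C] [MeasurableSpace S] [MeasurableSpace A]
    (M : CMDP C S A H) (π : C → S → A → ℝ) : Measure (Episode C S A H) :=
  ∑ c, ENNReal.ofReal (M.ctx c) •
    (rollout (π c) (M.trans c) (M.lossLaw c) H M.start).map (fun τ => (c, τ))

/-- Cumulative squared error of `f` on a dataset of episodes. -/
def sqErr {n : ℕ} (f : C → S → A → ℝ) (D : Fin n → Episode C S A H) : ℝ :=
  ∑ i, ∑ h, (f (D i).1 ((D i).2 h).1 ((D i).2 h).2.1 - ((D i).2 h).2.2.1) ^ 2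

/-- Log-likelihood of `P` on a dataset of episodes, with `log 0 = -∞`. -/
def logLik {n : ℕ} (P : C → S → A → S → ℝ) (D : Fin n → Episode C S A H) : EReal :=
  ∑ i, ∑ h, ENNReal.log (ENNReal.ofReal
    (P (D i).1 ((D i).2 h).1 ((D i).2 h).2.1 ((D i).2 h).2.2.2))

/-- Offline least squares regression oracle over `F` (a deterministic map of the dataset). -/
def IsLeastSquaresOracle (F : Finset (C → S → A → ℝ))
    (o : (n : ℕ) → (Fin n → Episode C S A H) → C → S → A → ℝ) : Prop :=
  ∀ n D, o n D ∈ F ∧ ∀ f ∈ F, sqErr (o n D) D ≤ sqErr f D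

/-- Offline log loss regression oracle over `FP` (a deterministic map of the dataset). -/
def IsLogLossOracle (FP : Finset (C → S → A → S → ℝ))
    (o : (n : ℕ) → (Fin n → Episode C S A H) → C → S → A → S → ℝ) : Prop :=
  ∀ n D, o n D ∈ FP ∧ ∀ P ∈ FP, logLik P D ≤ logLik (o n D) D

/-- The inputs of the algorithm: learning rate, bonus parameters and the two oracles. -/
structure Input (C S A : Type*) (H : ℕ) where
  η : ℝ
  βl : ℝ
  βP : ℝ
  lossOracle : (n : ℕ) → (Fin n → Episode C S A H) → C → S → A → ℝ
  dynOracle : (n : ℕ) → (Fin n → Episode C S A H) → C → S → A → S → ℝ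

section Algorithm

variable [DecidableEq S] (M : CMDP C S A H) (I : Input C S A H)

/-- The bonus `b_β(s, a)` computed from the past policies `π 0, …, π (n - 1)` and the current
dynamics estimate, for a fixed context. -/
def bonus {n : ℕ} (β : ℝ) (π : Fin n → S → A → ℝ) (Phat : S → A → S → ℝ) (s : S) (a : A) : ℝ :=
  min 1 ((β / 2) / (1 + ∑ i, occ M.start (π i) Phat (M.layer s) s a))

/-- The optimistic `Q`-function at step `h` of round `n` for context `c`, from the dataset `D` of
the past `n` episodes and the policies `π 0, …, π n` (for the context `c`) of the rounds up to and
including the current one. -/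
def optQ {n : ℕ} (D : Fin n → Episode C S A H) (c : C) (π : Fin (n + 1) → S → A → ℝ) (h : ℕ) :
    S → A → ℝ :=
  qRem
    (fun s a => I.lossOracle n D c s a -
      (bonus M I.βl (fun i : Fin n => π i.castSucc) (I.dynOracle n D c) s a +
        2 * H * bonus M I.βP (fun i : Fin n => π i.castSucc) (I.dynOracle n D c) s a))
    (I.dynOracle n D c) (π (Fin.last n)) (H - h)

/-- The context-dependent policy played at round `n`, as a function of the past `n` episodes. -/
def policy : (n : ℕ) → (Fin n → Episode C S A H) → C → S → A → ℝ
  | 0, _ => fun _ _ _ => 1 / Fintype.card A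
  | n + 1, D => fun c s a =>
      expWeights I.η (policy n (Fin.take n n.le_succ D) c)
        (optQ M I (Fin.take n n.le_succ D) c
          (fun i : Fin (n + 1) => policy i (Fin.take i i.isLt.le D) c) (M.layer s)) s a
termination_by n => n
decreasing_by
  all_goals first
    | exact i.isLt
    | exact Nat.lt_succ_self _

/-- `Q̂` at round `n`, context `c` and step `h`, as a function of the past `n` episodes. -/
def Qhat {n : ℕ} (D : Fin n → Episode C S A H) (c : C) (h : ℕ) (s : S) (a : A) : ℝ :=
  optQ M I D c
    (fun i : Fin (n + 1) => policy M I i (Fin.take i (Nat.lt_succ_iff.mp i.isLt) D) c) h s a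

/-- `V̂` at round `n`, context `c` and step `h`. -/
def Vhat {n : ℕ} (D : Fin n → Episode C S A H) (c : C) (h : ℕ) (s : S) : ℝ :=
  ∑ a, policy M I n D c s a * Qhat M I D c h s a

/-- The joint law of the first `n` episodes when the algorithm interacts with the CMDP. -/
def historyLaw [MeasurableSpace C] [MeasurableSpace S] [MeasurableSpace A] :
    (n : ℕ) → Measure (Fin n → Episode C S A H)
  | 0 => Measure.dirac Fin.elim0
  | n + 1 => (historyLaw n).bind fun D =>
      (M.episodeLaw (policy M I n D)).map
        (fun e => (Fin.snoc D e : Fin (n + 1) → Episode C S A H))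

/-- The optimism term: the sum over the rounds `t` of
`E_c [∑_h E_{π⋆, P⋆} [Q̂^t_h - ℓ⋆ - P⋆ V̂^t_{h+1}]]`, as a function of the history `D`. -/
def optimismTerm {T : ℕ} (πstar : C → S → A → ℝ) (D : Fin T → Episode C S A H) : ℝ :=
  ∑ t : Fin T, ∑ c, M.ctx c * ∑ h ∈ Finset.range H,
    expect M.start (πstar c) (M.trans c) h (fun s a =>
      Qhat M I (Fin.take t t.isLt.le D) c h s a - M.meanLoss c s a
        - ∑ s', M.trans c s a s' * Vhat M I (Fin.take t t.isLt.le D) c (h + 1) s')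

end Algorithm

end OPO

end

/-! Fix a round and a context, and let `N(s,a)` be the total occupancy of the past policies under
the estimated dynamics. Since `x - u ≤ x² / (4u)`, subtracting a bonus of order `β / (1 + N)` from
an estimation error leaves at most (squared error) · `(1 + N) / β`. For the loss the error is `f -
ℓ⋆`. For the dynamics it is the difference of the two next-step values, at most `H` in size and
controlled by the squared Hellinger distance. Clipping `Q̂` at `0` is harmless because `ℓ⋆` and `P⋆
V̂` are nonnegative (`optimistic_step_le`).

Now average over `π⋆` and `P⋆`. The occupancy of `π⋆` sums to one at each step, so the `1` in `1 +
N` costs a constant. It is also at most one, so the `N` part is bounded by the errors summed along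
the past policies under `P̂`: no coverage of `π⋆` by the data is needed. These policies were run
under `P⋆`, not `P̂`. `valRem_change_of_measure` exchanges the dynamics by backward induction; each
step loses a factor `1 + 1/H` and an additive multiple of the Hellinger distance, hence a factor `3`
overall.

It remains to bound, under the true dynamics and the past policies, the expected squared loss error
and Hellinger distance of the oracle outputs. For a fixed candidate, a product of weights with
conditional means at most one dominates the exponential of the realised score whenever the candidate
fits the data at least as well as the truth: Hoeffding weights for least squares, square-root
likelihood ratios for log loss. A second such product, `exp(-realised + expected/(H+1))`, links
realised and expected scores. The realised score cancels in the product of the two exponentials, so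
AM-GM and Markov applied to their sum bound the expected score (`historyLaw_episodeValue_ge_le`). A
union bound over rounds and candidates covers the data-dependent oracle outputs. -/

noncomputable section

namespace OPO

open ProbabilityTheory ENNReal

/-! ### Squared Hellinger distance and differences of expectations. -/

section Hellinger

variable {S : Type*} [Fintype S]

/-- The squared Hellinger distance, without normalisation. -/
def hel (p q : S → ℝ) : ℝ := ∑ s, (√(p s) - √(q s)) ^ 2

lemma hel_nonneg (p q : S → ℝ) : 0 ≤ hel p q := Finset.sum_nonneg fun _ _ => sq_nonneg _

lemma hel_eq {p q : S → ℝ} (hp : p ∈ stdSimplex ℝ S) (hq : q ∈ stdSimplex ℝ S) :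
    hel p q = 2 - 2 * ∑ s, √(p s) * √(q s) := by
  have h : ∀ s, (√(p s) - √(q s)) ^ 2 = p s + q s - 2 * (√(p s) * √(q s)) := fun s => by
    have h1 := Real.sq_sqrt (hp.1 s)
    have h2 := Real.sq_sqrt (hq.1 s)
    linear_combination h1 + h2
  unfold hel
  simp_rw [h]
  rw [Finset.sum_sub_distrib, Finset.sum_add_distrib, hp.2, hq.2, ← Finset.mul_sum]
  norm_num

lemma hel_le_two {p q : S → ℝ} (hp : p ∈ stdSimplex ℝ S) (hq : q ∈ stdSimplex ℝ S) :
    hel p q ≤ 2 := by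
  have : 0 ≤ ∑ s, √(p s) * √(q s) := Finset.sum_nonneg fun _ _ => by positivity
  rw [hel_eq hp hq]
  linarith

/-- Cauchy–Schwarz after factoring `p - q = (√p - √q)(√p + √q)`, with `(√p + √q)² ≤ 2(p + q)`. -/
lemma sq_sum_sub_mul_le {p q : S → ℝ} (hp : ∀ s, 0 ≤ p s) (hq : ∀ s, 0 ≤ q s) (U : S → ℝ) :
    (∑ s, (p s - q s) * U s) ^ 2 ≤ hel p q * ∑ s, (2 * (p s + q s)) * U s ^ 2 := by
  have h1 : ∑ s, (p s - q s) * U s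
      = ∑ s, (√(p s) - √(q s)) * ((√(p s) + √(q s)) * U s) :=
    Finset.sum_congr rfl fun s _ => by
      have h1 := Real.sq_sqrt (hp s)
      have h2 := Real.sq_sqrt (hq s)
      linear_combination (-U s) * h1 + U s * h2
  rw [h1]
  refine (Finset.sum_mul_sq_le_sq_mul_sq _ _ _).trans ?_
  refine mul_le_mul_of_nonneg_left (Finset.sum_le_sum fun s _ => ?_) (hel_nonneg p q)
  rw [mul_pow]
  refine mul_le_mul_of_nonneg_right ?_ (sq_nonneg _)
  have h1 := Real.sq_sqrt (hp s)
  have h2 := Real.sq_sqrt (hq s)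
  nlinarith [sq_nonneg (√(p s) - √(q s))]

lemma sum_mul_mem_Icc {p : S → ℝ} (hp : p ∈ stdSimplex ℝ S) {V : S → ℝ} {a b : ℝ}
    (hV : ∀ s, V s ∈ Set.Icc a b) : ∑ s, p s * V s ∈ Set.Icc a b := by
  constructor
  · calc a = ∑ s, p s * a := by rw [← Finset.sum_mul, hp.2, one_mul]
      _ ≤ _ := Finset.sum_le_sum fun s _ => mul_le_mul_of_nonneg_left (hV s).1 (hp.1 s)
  · calc _ ≤ ∑ s, p s * b :=
          Finset.sum_le_sum fun s _ => mul_le_mul_of_nonneg_left (hV s).2 (hp.1 s)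
      _ = b := by rw [← Finset.sum_mul, hp.2, one_mul]

/-- Both distributions have mass one, so `V` may be centred at `B / 2`; this makes the constant
exactly `B²`. -/
lemma sq_sub_le_hel {p q : S → ℝ} (hp : p ∈ stdSimplex ℝ S) (hq : q ∈ stdSimplex ℝ S)
    {V : S → ℝ} {B : ℝ} (hV : ∀ s, V s ∈ Set.Icc 0 B) :
    (∑ s, p s * V s - ∑ s, q s * V s) ^ 2 ≤ B ^ 2 * hel p q := by
  have h1 : ∑ s, p s * V s - ∑ s, q s * V s = ∑ s, (p s - q s) * (V s - B / 2) := by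
    have : ∑ s, (p s - q s) * (V s - B / 2)
        = ∑ s, p s * V s - ∑ s, q s * V s - (∑ s, p s - ∑ s, q s) * (B / 2) := by
      rw [← Finset.sum_sub_distrib, ← Finset.sum_sub_distrib, Finset.sum_mul,
        ← Finset.sum_sub_distrib]
      exact Finset.sum_congr rfl fun s _ => by ring
    rw [this, hp.2, hq.2]
    ring
  rw [h1]
  refine (sq_sum_sub_mul_le hp.1 hq.1 _).trans ?_
  rw [mul_comm]
  refine mul_le_mul_of_nonneg_right ?_ (hel_nonneg p q)
  calc ∑ s, (2 * (p s + q s)) * (V s - B / 2) ^ 2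
      ≤ ∑ s, (2 * (p s + q s)) * (B ^ 2 / 4) := by
        refine Finset.sum_le_sum fun s _ => mul_le_mul_of_nonneg_left ?_ ?_
        · have := hV s
          nlinarith [this.1, this.2]
        · have := hp.1 s
          have := hq.1 s
          linarith
    _ = B ^ 2 := by
        rw [← Finset.sum_mul, ← Finset.mul_sum, Finset.sum_add_distrib, hp.2, hq.2]
        ring

/-- The multiplicative form, tight when the values are small: uncentred Cauchy–Schwarz with `V² ≤ B
V`, then AM-GM. The AM-GM parameter `θ` is chosen so that `(1 + θ) / (1 - θ) = 1 + 1/B`, a loss that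
stays bounded when compounded `B` times. -/
lemma sum_mul_le_of_hel {p q : S → ℝ} (hp : p ∈ stdSimplex ℝ S) (hq : q ∈ stdSimplex ℝ S)
    {V : S → ℝ} {B : ℝ} (hB : 1 ≤ B) (hV : ∀ s, V s ∈ Set.Icc 0 B) :
    ∑ s, p s * V s ≤ (1 + 1 / B) * ∑ s, q s * V s + 9 / 4 * B ^ 2 * hel p q := by
  have h1 : (∑ s, p s * V s - ∑ s, q s * V s) ^ 2
      ≤ 2 * B * hel p q * (∑ s, p s * V s + ∑ s, q s * V s) := by
    rw [← Finset.sum_sub_distrib, ← Finset.sum_add_distrib]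
    have := sq_sum_sub_mul_le hp.1 hq.1 V
    simp_rw [← sub_mul]
    refine this.trans ?_
    rw [mul_comm (2 * B), mul_assoc]
    refine mul_le_mul_of_nonneg_left ?_ (hel_nonneg p q)
    rw [Finset.mul_sum]
    refine Finset.sum_le_sum fun s _ => ?_
    have h2 : V s ^ 2 ≤ B * V s := by nlinarith [(hV s).1, (hV s).2]
    have := mul_le_mul_of_nonneg_left h2 (add_nonneg (hp.1 s) (hq.1 s))
    nlinarith
  have ha := (sum_mul_mem_Icc hp hV).1
  have hb := (sum_mul_mem_Icc hq hV).1
  have hd := hel_nonneg p q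
  set a := ∑ s, p s * V s
  set b := ∑ s, q s * V s
  set d := hel p q
  have hB0 : 0 < B := by linarith
  by_contra hcon
  push Not at hcon
  -- `θ = 1 / (2 B + 1)`: `a - b ≤ θ (a + b) + B d / (2 θ)`
  have h3 : (2 * B + 1) * (a - b) ≤ (a + b) + (2 * B + 1) ^ 2 * B * d / 2 := by
    by_contra h
    push Not at h
    have h4 : 0 ≤ (a + b) + (2 * B + 1) ^ 2 * B * d / 2 := by positivity
    have h5 : ((a + b) + (2 * B + 1) ^ 2 * B * d / 2) ^ 2 < ((2 * B + 1) * (a - b)) ^ 2 :=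
      pow_lt_pow_left₀ h h4 two_ne_zero
    have h6 := mul_le_mul_of_nonneg_left h1 (sq_nonneg (2 * B + 1))
    nlinarith [sq_nonneg ((a + b) - (2 * B + 1) ^ 2 * B * d / 2)]
  have h7 : 2 * B * ((1 + 1 / B) * b + 9 / 4 * B ^ 2 * d) < 2 * B * a :=
    mul_lt_mul_of_pos_left hcon (by positivity)
  have h8 : 2 * B * ((1 + 1 / B) * b + 9 / 4 * B ^ 2 * d)
      = 2 * B * b + 2 * b + 9 / 2 * B ^ 3 * d := by
    field_simp
    ring
  have h9 : (2 * B + 1) ^ 2 * B * d / 2 ≤ 9 / 2 * B ^ 3 * d := by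
    have : (2 * B + 1) ^ 2 ≤ 9 * B ^ 2 := by nlinarith
    have := mul_le_mul_of_nonneg_right this (mul_nonneg hB0.le hd)
    nlinarith
  nlinarith

end Hellinger

/-! ### Backward values and the change of dynamics. -/

section Values

variable {S A : Type*} [Fintype S] [Fintype A]

/-- The expected sum of `x` over the next `n` steps. -/
def valRem (π : S → A → ℝ) (P : S → A → S → ℝ) (x : S → A → ℝ) : ℕ → S → ℝ
  | 0 => fun _ => 0
  | n + 1 => fun s => ∑ a, π s a * (x s a + ∑ s', P s a s' * valRem π P x n s')

/-- Forward occupancies and backward values compute the same sum; the starting step `k` is free so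
that the induction on the remaining steps can advance it. -/
lemma sum_stateProb_mul_valRem [DecidableEq S] (s₁ : S) (π : S → A → ℝ) (P : S → A → S → ℝ)
    (x : S → A → ℝ) (n k : ℕ) :
    ∑ s, stateProb s₁ π P k s * valRem π P x n s
      = ∑ h ∈ Finset.range n, expect s₁ π P (k + h) x := by
  induction n generalizing k with
  | zero => simp [valRem]
  | succ n ih =>
    rw [Finset.sum_range_succ']
    have : ∑ h ∈ Finset.range n, expect s₁ π P (k + (h + 1)) x
        = ∑ h ∈ Finset.range n, expect s₁ π P (k + 1 + h) x :=
      Finset.sum_congr rfl fun h _ => by congr 1; ring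
    rw [this, ← ih (k + 1)]
    simp only [valRem, stateProb, expect, occ, add_zero]
    simp only [mul_add, Finset.sum_add_distrib, Finset.mul_sum, Finset.sum_mul]
    rw [add_comm]
    congr 1
    · symm
      rw [Finset.sum_comm]
      refine Finset.sum_congr rfl fun s _ => ?_
      rw [Finset.sum_comm]
      exact Finset.sum_congr rfl fun a _ => Finset.sum_congr rfl fun s' _ => by ring
    · exact Finset.sum_congr rfl fun s _ => Finset.sum_congr rfl fun a _ => by ring

lemma sum_expect_eq_valRem [DecidableEq S] (s₁ : S) (π : S → A → ℝ) (P : S → A → S → ℝ)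
    (x : S → A → ℝ) (n : ℕ) :
    ∑ h ∈ Finset.range n, expect s₁ π P h x = valRem π P x n s₁ := by
  have := sum_stateProb_mul_valRem s₁ π P x n 0
  simpa [stateProb] using this.symm

lemma valRem_mem_Icc {π : S → A → ℝ} (hπ : IsPolicy π) {P : S → A → S → ℝ}
    (hP : ∀ s a, P s a ∈ stdSimplex ℝ S) {x : S → A → ℝ} (hx : ∀ s a, x s a ∈ Set.Icc (0 : ℝ) 1)
    (n : ℕ) (s : S) : valRem π P x n s ∈ Set.Icc (0 : ℝ) n := by
  induction n generalizing s with
  | zero => simp [valRem]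
  | succ n ih =>
    refine sum_mul_mem_Icc (hπ s) fun a => ?_
    have h1 := sum_mul_mem_Icc (hP s a) ih
    have h2 := hx s a
    push_cast
    exact ⟨add_nonneg h2.1 h1.1, by linarith [h2.2, h1.2]⟩

lemma valRem_nonneg {π : S → A → ℝ} (hπ : IsPolicy π) {P : S → A → S → ℝ}
    (hP : ∀ s a, P s a ∈ stdSimplex ℝ S) {x : S → A → ℝ} (hx : ∀ s a, 0 ≤ x s a)
    (n : ℕ) (s : S) : 0 ≤ valRem π P x n s := by
  induction n generalizing s with
  | zero => simp [valRem]
  | succ n ih =>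
    refine Finset.sum_nonneg fun a _ => mul_nonneg ((hπ s).1 a) (add_nonneg (hx s a) ?_)
    exact Finset.sum_nonneg fun s' _ => mul_nonneg ((hP s a).1 s') (ih s')

lemma valRem_add_mul (π : S → A → ℝ) (P : S → A → S → ℝ) (x y : S → A → ℝ) (k : ℝ)
    (n : ℕ) (s : S) :
    valRem π P (fun s a => x s a + k * y s a) n s = valRem π P x n s + k * valRem π P y n s := by
  induction n generalizing s with
  | zero => simp [valRem]
  | succ n ih =>
    simp only [valRem, ih]
    rw [Finset.mul_sum, ← Finset.sum_add_distrib]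
    refine Finset.sum_congr rfl fun a _ => ?_
    simp_rw [mul_add, Finset.sum_add_distrib]
    have : ∑ s', P s a s' * (k * valRem π P y n s') = k * ∑ s', P s a s' * valRem π P y n s' := by
      rw [Finset.mul_sum]
      exact Finset.sum_congr rfl fun s' _ => by ring
    rw [this]
    ring

lemma valRem_const_mul (π : S → A → ℝ) (P : S → A → S → ℝ) (y : S → A → ℝ) (k : ℝ) (n : ℕ)
    (s : S) : valRem π P (fun s a => k * y s a) n s = k * valRem π P y n s := by
  -- With both scores zero and factor one this reads `v = v + v`, so the value of the zero score
  -- vanishes.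
  have h0 := valRem_add_mul π P (fun _ _ => 0) (fun _ _ => 0) 1 n s
  have h1 := valRem_add_mul π P (fun _ _ => 0) y k n s
  simp only [mul_zero, zero_add] at h0 h1
  linarith

lemma valRem_mono {π : S → A → ℝ} (hπ : IsPolicy π) {P : S → A → S → ℝ}
    (hP : ∀ s a, P s a ∈ stdSimplex ℝ S) {x y : S → A → ℝ} (hxy : ∀ s a, x s a ≤ y s a)
    (n : ℕ) (s : S) : valRem π P x n s ≤ valRem π P y n s := by
  induction n generalizing s with
  | zero => simp [valRem]
  | succ n ih =>
    refine Finset.sum_le_sum fun a _ => mul_le_mul_of_nonneg_left ?_ ((hπ s).1 a)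
    exact add_le_add (hxy s a) (Finset.sum_le_sum fun s' _ =>
      mul_le_mul_of_nonneg_left (ih s') ((hP s a).1 s'))

lemma one_add_inv_pow_le_three {H : ℕ} (hH : 1 ≤ H) : (1 + 1 / (H : ℝ)) ^ H ≤ 3 := by
  have hH' : (0 : ℝ) < H := by exact_mod_cast hH
  have h1 : 1 + 1 / (H : ℝ) ≤ Real.exp (1 / H) := by
    have := Real.add_one_le_exp (1 / (H : ℝ))
    linarith
  calc (1 + 1 / (H : ℝ)) ^ H ≤ Real.exp (1 / H) ^ H := pow_le_pow_left₀ (by positivity) h1 _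
    _ = Real.exp 1 := by
        rw [← Real.exp_nat_mul]
        congr 1
        field_simp
    _ ≤ 3 := by linarith [Real.exp_one_lt_d9]

/-- Change of measure between two dynamics at the price of the expected Hellinger distance. -/
lemma valRem_change_of_measure {H : ℕ} (hH : 1 ≤ H) {π : S → A → ℝ} (hπ : IsPolicy π)
    {P Q : S → A → S → ℝ} (hP : ∀ s a, P s a ∈ stdSimplex ℝ S)
    (hQ : ∀ s a, Q s a ∈ stdSimplex ℝ S) {x : S → A → ℝ}
    (hx : ∀ s a, x s a ∈ Set.Icc (0 : ℝ) 1) (s : S) :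
    valRem π P x H s ≤ 3 * (valRem π Q x H s
      + 9 / 4 * (H : ℝ) ^ 2 * valRem π Q (fun s a => hel (P s a) (Q s a)) H s) := by
  have hH' : (1 : ℝ) ≤ H := by exact_mod_cast hH
  rw [← valRem_add_mul]
  set y : S → A → ℝ := fun s a => x s a + 9 / 4 * (H : ℝ) ^ 2 * hel (P s a) (Q s a) with hy
  have hy0 : ∀ s a, 0 ≤ y s a := fun s a =>
    add_nonneg (hx s a).1 (mul_nonneg (by positivity) (hel_nonneg _ _))
  have hr : 1 ≤ 1 + 1 / (H : ℝ) := le_add_of_nonneg_right (by positivity)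
  -- The Hellinger price of each step is absorbed into the score `y`, so that only the factor `1 +
  -- 1/H` compounds. Values of `x` stay in `[0, H]`, which allows `B = H`.
  have key : ∀ n ≤ H, ∀ s, valRem π P x n s ≤ (1 + 1 / (H : ℝ)) ^ n * valRem π Q y n s := by
    intro n hn
    induction n with
    | zero => simp [valRem]
    | succ n ih =>
      intro s
      have ih := ih (by omega)
      simp only [valRem]
      rw [Finset.mul_sum]
      refine Finset.sum_le_sum fun a _ => ?_
      rw [mul_left_comm]
      refine mul_le_mul_of_nonneg_left ?_ ((hπ s).1 a)
      have hV : ∀ s', valRem π P x n s' ∈ Set.Icc (0 : ℝ) H := fun s' => by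
        have := valRem_mem_Icc hπ hP hx n s'
        refine ⟨this.1, this.2.trans ?_⟩
        exact_mod_cast (by omega : n ≤ H)
      have h1 := sum_mul_le_of_hel (hP s a) (hQ s a) hH' hV
      have h2 : ∑ s', Q s a s' * valRem π P x n s'
          ≤ (1 + 1 / (H : ℝ)) ^ n * ∑ s', Q s a s' * valRem π Q y n s' := by
        rw [Finset.mul_sum]
        refine Finset.sum_le_sum fun s' _ => ?_
        rw [mul_left_comm]
        exact mul_le_mul_of_nonneg_left (ih s') ((hQ s a).1 s')
      have h3 : y s a ≤ (1 + 1 / (H : ℝ)) ^ (n + 1) * y s a :=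
        le_mul_of_one_le_left (hy0 s a) (one_le_pow₀ hr)
      have h4 := mul_le_mul_of_nonneg_left h2 (zero_le_one.trans hr)
      calc x s a + ∑ s', P s a s' * valRem π P x n s'
          ≤ y s a + (1 + 1 / (H : ℝ)) * ∑ s', Q s a s' * valRem π P x n s' := by
            simp only [hy]
            linarith
        _ ≤ _ := by
            rw [mul_add, pow_succ']
            rw [pow_succ'] at h3
            linarith
  refine (key H le_rfl s).trans ?_
  exact mul_le_mul_of_nonneg_right (one_add_inv_pow_le_three hH) (valRem_nonneg hπ hQ hy0 H s)

end Values

/-! ### Range of the clipped `Q`-function, and exponential weights. -/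

lemma qRem_mem_Icc {S A : Type*} [Fintype S] [Fintype A] {lhat : S → A → ℝ} (hl : ∀ s a, lhat s a ≤ 1) {P : S → A → S → ℝ}
    (hP : ∀ s a, P s a ∈ stdSimplex ℝ S) {π : S → A → ℝ} (hπ : IsPolicy π) (n : ℕ) (s : S)
    (a : A) : qRem lhat P π n s a ∈ Set.Icc (0 : ℝ) n := by
  induction n generalizing s a with
  | zero => simp [qRem]
  | succ n ih =>
    have := sum_mul_mem_Icc (hP s a) fun s' => sum_mul_mem_Icc (hπ s') fun a' => ih s' a'
    refine ⟨le_max_left _ _, max_le (by positivity) ?_⟩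
    push_cast
    linarith [this.2, hl s a]

/-- `Q` has an extra state argument because the update at `s` uses the `Q`-function of the layer of
`s`. -/
lemma isPolicy_expWeights {S A : Type*} [Fintype A] (η : ℝ) {π : S → A → ℝ} (hπ : IsPolicy π) (Q : S → S → A → ℝ) :
    IsPolicy fun s a => expWeights η π (Q s) s a := by
  intro s
  have h0 : ∀ a, 0 ≤ π s a * Real.exp (-η * Q s s a) := fun a =>
    mul_nonneg ((hπ s).1 a) (Real.exp_pos _).le
  refine ⟨fun a => div_nonneg (h0 a) (Finset.sum_nonneg fun a _ => h0 a), ?_⟩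
  simp only [expWeights]
  rw [← Finset.sum_div, div_self]
  intro h
  rw [Finset.sum_eq_zero_iff_of_nonneg fun a _ => h0 a] at h
  have h1 : ∀ a, π s a = 0 := fun a =>
    (mul_eq_zero.1 (h a (Finset.mem_univ a))).resolve_right (Real.exp_pos _).ne'
  have := (hπ s).2
  simp [h1] at this

/-! ### Occupancy measures and layers. -/

section Occupancy

variable {S A : Type*} [Fintype S] [Fintype A] [DecidableEq S]

lemma stateProb_nonneg (s₁ : S) {π : S → A → ℝ} (hπ : IsPolicy π) {P : S → A → S → ℝ}
    (hP : ∀ s a, P s a ∈ stdSimplex ℝ S) (h : ℕ) (s : S) : 0 ≤ stateProb s₁ π P h s := by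
  induction h generalizing s with
  | zero => simp only [stateProb]; split_ifs <;> norm_num
  | succ h ih =>
    exact Finset.sum_nonneg fun s' _ => Finset.sum_nonneg fun a _ =>
      mul_nonneg (mul_nonneg (ih s') ((hπ s').1 a)) ((hP s' a).1 s)

lemma sum_stateProb (s₁ : S) {π : S → A → ℝ} (hπ : IsPolicy π) {P : S → A → S → ℝ}
    (hP : ∀ s a, P s a ∈ stdSimplex ℝ S) (h : ℕ) : ∑ s, stateProb s₁ π P h s = 1 := by
  induction h with
  | zero => simp [stateProb]
  | succ h ih =>
    simp only [stateProb]
    rw [Finset.sum_comm, ← ih]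
    refine Finset.sum_congr rfl fun s _ => ?_
    rw [Finset.sum_comm]
    simp_rw [← Finset.mul_sum, (hP s _).2, mul_one, ← Finset.mul_sum, (hπ s).2, mul_one]

lemma occ_nonneg (s₁ : S) {π : S → A → ℝ} (hπ : IsPolicy π) {P : S → A → S → ℝ}
    (hP : ∀ s a, P s a ∈ stdSimplex ℝ S) (h : ℕ) (s : S) (a : A) : 0 ≤ occ s₁ π P h s a :=
  mul_nonneg (stateProb_nonneg s₁ hπ hP h s) ((hπ s).1 a)

lemma sum_occ (s₁ : S) {π : S → A → ℝ} (hπ : IsPolicy π) {P : S → A → S → ℝ}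
    (hP : ∀ s a, P s a ∈ stdSimplex ℝ S) (h : ℕ) : ∑ s, ∑ a, occ s₁ π P h s a = 1 := by
  simp_rw [occ, ← Finset.mul_sum, (hπ _).2, mul_one]
  exact sum_stateProb s₁ hπ hP h

lemma occ_le_one (s₁ : S) {π : S → A → ℝ} (hπ : IsPolicy π) {P : S → A → S → ℝ}
    (hP : ∀ s a, P s a ∈ stdSimplex ℝ S) (h : ℕ) (s : S) (a : A) : occ s₁ π P h s a ≤ 1 := by
  rw [← sum_occ s₁ hπ hP h]
  refine (Finset.single_le_sum (f := fun a => occ s₁ π P h s a)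
    (fun a _ => occ_nonneg s₁ hπ hP h s a) (Finset.mem_univ a)).trans ?_
  exact Finset.single_le_sum (f := fun s => ∑ a, occ s₁ π P h s a)
    (fun s _ => Finset.sum_nonneg fun a _ => occ_nonneg s₁ hπ hP h s a) (Finset.mem_univ s)

lemma layer_eq_of_stateProb_ne_zero {H : ℕ} {layer : S → ℕ} {s₁ : S} (h₁ : layer s₁ = 0)
    {π : S → A → ℝ} {P : S → A → S → ℝ}
    (hP : ∀ s a s', layer s < H → P s a s' ≠ 0 → layer s' = layer s + 1) {h : ℕ} (hh : h ≤ H)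
    {s : S} (hs : stateProb s₁ π P h s ≠ 0) : layer s = h := by
  induction h generalizing s with
  | zero =>
    simp only [stateProb, ne_eq, ite_eq_right_iff, one_ne_zero, imp_false, not_not] at hs
    rw [hs, h₁]
  | succ h ih =>
    simp only [stateProb] at hs
    obtain ⟨s', -, hs'⟩ := Finset.exists_ne_zero_of_sum_ne_zero hs
    obtain ⟨a, -, ha⟩ := Finset.exists_ne_zero_of_sum_ne_zero hs'
    have h1 := ih (by omega) (left_ne_zero_of_mul (left_ne_zero_of_mul ha))
    rw [hP s' a s (by omega) (right_ne_zero_of_mul ha), h1]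

end Occupancy

/-! ### What a bonus leaves of an estimation error. -/

/-- AM-GM gives `x - u ≤ x² / (4u)`; truncating `u` at `1` costs nothing because `x ≤ 1`. -/
lemma sub_min_one_le {u x : ℝ} (hu : 0 < u) (hx : x ≤ 1) : x - min 1 u ≤ x ^ 2 / (4 * u) := by
  have h0 : 0 ≤ x ^ 2 / (4 * u) := by positivity
  rcases le_total 1 u with h | h
  · rw [min_eq_left h]
    linarith
  · rw [min_eq_right h, le_div_iff₀ (by positivity)]
    nlinarith [sq_nonneg (x - 2 * u)]

lemma sub_bonus_le {β N x : ℝ} (hβ : 0 < β) (hN : 0 ≤ N) (hx : x ≤ 1) :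
    x - min 1 ((β / 2) / (1 + N)) ≤ x ^ 2 * (1 + N) / (2 * β) := by
  refine (sub_min_one_le (by positivity) hx).trans_eq ?_
  field_simp
  ring

/-- The previous bound at `z / 2`, doubled. The minimum with `1` keeps the error a score in `[0,
1]`, as the change of dynamics requires. -/
lemma sub_two_mul_bonus_le {β N d z : ℝ} (hβ : 0 < β) (hN : 0 ≤ N) (hz : z ≤ 1) (hd : 0 ≤ d)
    (hzd : z ^ 2 ≤ d) :
    z - 2 * min 1 ((β / 2) / (1 + N)) ≤ min 1 d * (1 + N) / (4 * β) := by
  have hu : 0 < (β / 2) / (1 + N) := by positivity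
  have hb : 0 < min 1 ((β / 2) / (1 + N)) := lt_min one_pos hu
  have hd' : 0 ≤ min 1 d := le_min zero_le_one hd
  have h0 : 0 ≤ min 1 d * (1 + N) / (4 * β) := by positivity
  -- No lower bound on `z` is assumed, so `z² ≤ 1` is available only for `z ≥ 0`; for negative `z`
  -- the left side is negative.
  rcases le_total z 0 with hz0 | hz0
  · linarith
  have h1 := sub_min_one_le hu (by linarith : z / 2 ≤ 1)
  have h2 : (z / 2) ^ 2 / (4 * ((β / 2) / (1 + N))) = z ^ 2 * (1 + N) / (4 * β) / 2 := by
    field_simp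
  have h3 : z ^ 2 * (1 + N) / (4 * β) ≤ min 1 d * (1 + N) / (4 * β) := by
    have : z ^ 2 ≤ min 1 d := le_min (by nlinarith) hzd
    gcongr
  linarith

/-! ### Optimism in one round and one context. -/

section Optimism

variable {C S A : Type*} [Fintype C] [Fintype S] [Fintype A] [DecidableEq S] {H : ℕ}

/-- The optimistic temporal difference at a state of layer `h`. -/
lemma optimistic_step_le (hH : 1 ≤ H) (M : CMDP C S A H) {p phat : S → A → S → ℝ}
    (hp : ∀ s a, p s a ∈ stdSimplex ℝ S) (hphat : ∀ s a, phat s a ∈ stdSimplex ℝ S)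
    {π : S → A → ℝ} (hπ : IsPolicy π) {n : ℕ} {πs : Fin n → S → A → ℝ}
    (hπs : ∀ i, IsPolicy (πs i)) {f ℓ : S → A → ℝ} (hf : ∀ s a, f s a ∈ Set.Icc (0 : ℝ) 1)
    (hℓ : ∀ s a, ℓ s a ∈ Set.Icc (0 : ℝ) 1) {βl βP : ℝ} (hβl : 0 < βl) (hβP : 0 < βP)
    {lhat : S → A → ℝ} (hlhat : lhat = fun s a => f s a -
      (bonus M βl πs phat s a + 2 * H * bonus M βP πs phat s a)) {h : ℕ} (hh : h < H)
    (s : S) (a : A) :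
    qRem lhat phat π (H - h) s a - ℓ s a
        - ∑ s', p s a s' * ∑ a', π s' a' * qRem lhat phat π (H - (h + 1)) s' a'
      ≤ ((f s a - ℓ s a) ^ 2 / (2 * βl) + H * min 1 (hel (phat s a) (p s a)) / (4 * βP))
          * (1 + ∑ i, occ M.start (πs i) phat (M.layer s) s a) := by
  have hH' : (0 : ℝ) < H := by exact_mod_cast hH
  set N := ∑ i, occ M.start (πs i) phat (M.layer s) s a with hN
  have hN0 : 0 ≤ N := Finset.sum_nonneg fun i _ => occ_nonneg _ (hπs i) hphat _ _ _
  have hb : ∀ {β}, 0 < β → ∀ s a, 0 ≤ bonus M β πs phat s a := fun {β} hβ s a => by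
    have : 0 ≤ ∑ i, occ M.start (πs i) phat (M.layer s) s a :=
      Finset.sum_nonneg fun i _ => occ_nonneg _ (hπs i) hphat _ _ _
    exact le_min zero_le_one (by positivity)
  have hl1 : ∀ s a, lhat s a ≤ 1 := fun s a => by
    have h1 := hb hβl s a
    have h2 := mul_nonneg (by positivity : (0 : ℝ) ≤ 2 * H) (hb hβP s a)
    rw [hlhat]
    linarith [(hf s a).2]
  have hd := hel_nonneg (phat s a) (p s a)
  have hV : ∀ s', ∑ a', π s' a' * qRem lhat phat π (H - (h + 1)) s' a' ∈ Set.Icc (0 : ℝ) H :=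
    fun s' => sum_mul_mem_Icc (hπ s') fun a' => by
      have := qRem_mem_Icc hl1 hphat hπ (H - (h + 1)) s' a'
      refine ⟨this.1, this.2.trans ?_⟩
      exact_mod_cast Nat.sub_le _ _
  have hsub : H - h = (H - (h + 1)) + 1 := by omega
  rw [hsub, qRem]
  set V : S → ℝ := fun s' => ∑ a', π s' a' * qRem lhat phat π (H - (h + 1)) s' a' with hVdef
  have h1 := sum_mul_mem_Icc (hp s a) hV
  have h2 := sum_mul_mem_Icc (hphat s a) hV
  have h3 := sq_sub_le_hel (hphat s a) (hp s a) hV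
  change max 0 (lhat s a + ∑ s', phat s a s' * V s') - ℓ s a - ∑ s', p s a s' * V s' ≤ _
  change ∑ s', phat s a s' * V s' ∈ _ at h2
  change ∑ s', p s a s' * V s' ∈ _ at h1
  change (∑ s', phat s a s' * V s' - ∑ s', p s a s' * V s') ^ 2 ≤ _ at h3
  set x := ∑ s', phat s a s' * V s'
  set y := ∑ s', p s a s' * V s'
  have hd' : 0 ≤ min 1 (hel (phat s a) (p s a)) := le_min zero_le_one hd
  have hR : 0 ≤ ((f s a - ℓ s a) ^ 2 / (2 * βl)
      + H * min 1 (hel (phat s a) (p s a)) / (4 * βP)) * (1 + N) := by positivity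
  have h4 : f s a - ℓ s a - bonus M βl πs phat s a ≤ (f s a - ℓ s a) ^ 2 * (1 + N) / (2 * βl) :=
    sub_bonus_le hβl hN0 (by linarith [(hf s a).2, (hℓ s a).1])
  -- Dividing by `H` brings the value difference below `1`; multiplying back produces the `2 * H` in
  -- front of the dynamics bonus.
  have h5 : (x - y) / H - 2 * bonus M βP πs phat s a
      ≤ min 1 (hel (phat s a) (p s a)) * (1 + N) / (4 * βP) := by
    refine sub_two_mul_bonus_le hβP hN0 ?_ hd ?_
    · rw [div_le_one hH']
      linarith [h1.1, h2.2]
    · rw [div_pow, div_le_iff₀ (by positivity)]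
      linarith
  have h6 := mul_le_mul_of_nonneg_left h5 hH'.le
  have h7 : (H : ℝ) * ((x - y) / H - 2 * bonus M βP πs phat s a)
      = x - y - 2 * H * bonus M βP πs phat s a := by
    field_simp
  rw [h7] at h6
  -- When the clipping is active the left side is nonpositive and the right side nonnegative.
  rcases le_total (lhat s a + x) 0 with h | h
  · rw [max_eq_left h]
    linarith [(hℓ s a).1, h1.1]
  · rw [max_eq_right h, hlhat]
    have : ((f s a - ℓ s a) ^ 2 / (2 * βl) + H * min 1 (hel (phat s a) (p s a)) / (4 * βP))
        * (1 + N) = (f s a - ℓ s a) ^ 2 * (1 + N) / (2 * βl)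
          + H * (min 1 (hel (phat s a) (p s a)) * (1 + N) / (4 * βP)) := by ring
    rw [this]
    linarith

/-- The optimism term of one round and one context is controlled by the expected estimation errors
under the past policies and the true dynamics. -/
lemma sum_expect_optimistic_step_le (hH : 1 ≤ H) (M : CMDP C S A H) {p phat : S → A → S → ℝ}
    (hp : ∀ s a, p s a ∈ stdSimplex ℝ S)
    (hpl : ∀ s a s', M.layer s < H → p s a s' ≠ 0 → M.layer s' = M.layer s + 1)
    (hphat : ∀ s a, phat s a ∈ stdSimplex ℝ S)
    {π πstar : S → A → ℝ} (hπ : IsPolicy π) (hπstar : IsPolicy πstar)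
    {n : ℕ} {πs : Fin n → S → A → ℝ}
    (hπs : ∀ i, IsPolicy (πs i)) {f ℓ : S → A → ℝ} (hf : ∀ s a, f s a ∈ Set.Icc (0 : ℝ) 1)
    (hℓ : ∀ s a, ℓ s a ∈ Set.Icc (0 : ℝ) 1) {βl βP : ℝ} (hβl : 0 < βl) (hβP : 0 < βP)
    {lhat : S → A → ℝ} (hlhat : lhat = fun s a => f s a -
      (bonus M βl πs phat s a + 2 * H * bonus M βP πs phat s a)) :
    ∑ h ∈ Finset.range H, expect M.start πstar p h (fun s a => qRem lhat phat π (H - h) s a - ℓ s a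
        - ∑ s', p s a s' * ∑ a', π s' a' * qRem lhat phat π (H - (h + 1)) s' a')
      ≤ H / (2 * βl) + (H : ℝ) ^ 2 / (4 * βP)
        + 1 / (2 * βl) * ∑ i, 3 * (valRem (πs i) p (fun s a => (f s a - ℓ s a) ^ 2) H M.start
            + 9 / 4 * (H : ℝ) ^ 2 * valRem (πs i) p (fun s a => hel (phat s a) (p s a)) H M.start)
        + H / (4 * βP) * ∑ i, 3 * (valRem (πs i) p (fun s a => hel (phat s a) (p s a)) H M.start
            + 9 / 4 * (H : ℝ) ^ 2 *
              valRem (πs i) p (fun s a => hel (phat s a) (p s a)) H M.start) := by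
  have hH' : (0 : ℝ) < H := by exact_mod_cast hH
  set g : S → A → ℝ := fun s a => (f s a - ℓ s a) ^ 2 with hg
  set d : S → A → ℝ := fun s a => min 1 (hel (phat s a) (p s a)) with hd
  have hg01 : ∀ s a, g s a ∈ Set.Icc (0 : ℝ) 1 := fun s a => by
    have h1 := hf s a
    have h2 := hℓ s a
    exact ⟨sq_nonneg _, by simp only [hg]; nlinarith [h1.1, h1.2, h2.1, h2.2]⟩
  have hd01 : ∀ s a, d s a ∈ Set.Icc (0 : ℝ) 1 := fun s a =>
    ⟨le_min zero_le_one (hel_nonneg _ _), min_le_left _ _⟩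
  set R : S → A → ℝ := fun s a => g s a / (2 * βl) + H * d s a / (4 * βP) with hR
  have hR0 : ∀ s a, 0 ≤ R s a := fun s a => by
    have := (hg01 s a).1
    have := (hd01 s a).1
    simp only [hR]
    positivity
  have hR1 : ∀ s a, R s a ≤ 1 / (2 * βl) + H / (4 * βP) := fun s a => by
    have h1 := (hg01 s a).2
    have h2 := mul_le_mul_of_nonneg_left (hd01 s a).2 hH'.le
    rw [mul_one] at h2
    simp only [hR]
    gcongr
  have hstep : ∀ h ∈ Finset.range H, expect M.start πstar p h
      (fun s a => qRem lhat phat π (H - h) s a - ℓ s a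
        - ∑ s', p s a s' * ∑ a', π s' a' * qRem lhat phat π (H - (h + 1)) s' a')
      ≤ (1 / (2 * βl) + H / (4 * βP)) + ∑ i, expect M.start (πs i) phat h R := by
    intro h hh
    have hh : h < H := Finset.mem_range.1 hh
    have h1 : ∀ s a, occ M.start πstar p h s a * (qRem lhat phat π (H - h) s a - ℓ s a
        - ∑ s', p s a s' * ∑ a', π s' a' * qRem lhat phat π (H - (h + 1)) s' a')
        ≤ occ M.start πstar p h s a * (1 / (2 * βl) + H / (4 * βP))
          + ∑ i, occ M.start (πs i) phat h s a * R s a := by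
      intro s a
      have ho0 := occ_nonneg M.start hπstar hp h s a
      have ho1 := occ_le_one M.start hπstar hp h s a
      have hN0 : 0 ≤ ∑ i, occ M.start (πs i) phat h s a :=
        Finset.sum_nonneg fun i _ => occ_nonneg _ (hπs i) hphat _ _ _
      -- The bonus measures occupancy at step `M.layer s`, which is `h` only for states reachable at
      -- step `h`; at the others the weight is zero.
      by_cases hs : stateProb M.start πstar p h s = 0
      · have : occ M.start πstar p h s a = 0 := by rw [occ, hs, zero_mul]
        rw [this, zero_mul, zero_mul, zero_add, ← Finset.sum_mul]
        exact mul_nonneg hN0 (hR0 s a)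
      · have hl := layer_eq_of_stateProb_ne_zero ((M.layer_start _).2 rfl) hpl hh.le hs
        have h2 := optimistic_step_le hH M hp hphat hπ hπs hf hℓ hβl hβP hlhat hh s a
        rw [hl] at h2
        change _ ≤ R s a * _ at h2
        refine (mul_le_mul_of_nonneg_left h2 ho0).trans ?_
        rw [← Finset.sum_mul]
        -- In `1 + N` the two summands are treated differently: with `1` the occupancy of `πstar` is
        -- kept, to be summed to one; with `N` it is bounded by one, leaving only the past policies.
        have h3 := mul_le_mul_of_nonneg_left (hR1 s a) ho0
        have h4 := mul_le_mul_of_nonneg_right ho1 (mul_nonneg hN0 (hR0 s a))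
        nlinarith
    calc _ ≤ ∑ s, ∑ a, (occ M.start πstar p h s a * (1 / (2 * βl) + H / (4 * βP))
          + ∑ i, occ M.start (πs i) phat h s a * R s a) :=
          Finset.sum_le_sum fun s _ => Finset.sum_le_sum fun a _ => h1 s a
      _ = _ := by
          simp_rw [Finset.sum_add_distrib, ← Finset.sum_mul]
          rw [sum_occ _ hπstar hp, one_mul]
          congr 1
          simp_rw [Finset.sum_mul, expect]
          symm
          rw [Finset.sum_comm]
          refine Finset.sum_congr rfl fun s _ => ?_
          rw [Finset.sum_comm]
  refine (Finset.sum_le_sum hstep).trans ?_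
  rw [Finset.sum_add_distrib, Finset.sum_const, Finset.card_range, nsmul_eq_mul, Finset.sum_comm]
  simp_rw [sum_expect_eq_valRem]
  have hval : ∀ i, valRem (πs i) phat R H M.start
      ≤ 1 / (2 * βl) * (3 * (valRem (πs i) p g H M.start
            + 9 / 4 * (H : ℝ) ^ 2 * valRem (πs i) p (fun s a => hel (phat s a) (p s a)) H M.start))
        + H / (4 * βP) * (3 * (valRem (πs i) p (fun s a => hel (phat s a) (p s a)) H M.start
            + 9 / 4 * (H : ℝ) ^ 2 *
              valRem (πs i) p (fun s a => hel (phat s a) (p s a)) H M.start)) := by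
    intro i
    have e1 : valRem (πs i) phat R H M.start
        = 1 / (2 * βl) * valRem (πs i) phat g H M.start
          + H / (4 * βP) * valRem (πs i) phat d H M.start := by
      rw [← valRem_const_mul, ← valRem_add_mul]
      congr 1
      funext s a
      simp only [hR]
      ring
    have e2 := valRem_change_of_measure hH (hπs i) hphat hp hg01 M.start
    have e3 := valRem_change_of_measure hH (hπs i) hphat hp hd01 M.start
    -- The truncation of the Hellinger distance has served its purpose in the change of dynamics and
    -- is dropped.
    have e4 : valRem (πs i) p d H M.start
        ≤ valRem (πs i) p (fun s a => hel (phat s a) (p s a)) H M.start :=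
      valRem_mono (hπs i) hp (fun s a => min_le_right _ _) H M.start
    rw [e1]
    refine add_le_add (mul_le_mul_of_nonneg_left e2 (by positivity))
      (mul_le_mul_of_nonneg_left (e3.trans ?_) (by positivity))
    linarith
  have := Finset.sum_le_sum fun i (_ : i ∈ Finset.univ) => hval i
  rw [Finset.sum_add_distrib, ← Finset.mul_sum _ _ (1 / (2 * βl)),
    ← Finset.mul_sum _ _ (H / (4 * βP))] at this
  have e : (H : ℝ) * (1 / (2 * βl) + H / (4 * βP)) = H / (2 * βl) + (H : ℝ) ^ 2 / (4 * βP) := by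
    ring
  rw [e]
  linarith

end Optimism

/-! ### The played policies are policies. -/

section Policies

variable {C S A : Type*} [Fintype C] [Fintype S] [Fintype A] [DecidableEq S] {H : ℕ}

lemma isPolicy_policy [Nonempty A] (M : CMDP C S A H) (I : Input C S A H) (n : ℕ)
    (D : Fin n → Episode C S A H) (c : C) : IsPolicy (policy M I n D c) := by
  induction n with
  | zero =>
    intro s
    rw [policy]
    refine ⟨fun a => by positivity, ?_⟩
    simp
  | succ n ih =>
    rw [policy]
    exact isPolicy_expWeights I.η (ih _) _

end Policies

/-! ### Auxiliary facts for trajectory laws. -/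

lemma measurable_fin_cons {Ω α : Type*} [MeasurableSpace Ω] [MeasurableSpace α] {n : ℕ}
    {f : Ω → α} {g : Ω → Fin n → α} (hf : Measurable f) (hg : Measurable g) :
    Measurable fun ω => (Fin.cons (f ω) (g ω) : Fin (n + 1) → α) := by
  rw [measurable_pi_iff]
  intro i
  refine Fin.cases ?_ (fun j => ?_) i
  · simpa using hf
  · simpa [Function.comp_def] using (measurable_pi_apply j).comp hg

lemma measurable_fin_snoc {Ω α : Type*} [MeasurableSpace Ω] [MeasurableSpace α] {n : ℕ}
    {f : Ω → α} {g : Ω → Fin n → α} (hf : Measurable f) (hg : Measurable g) :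
    Measurable fun ω => (Fin.snoc (g ω) (f ω) : Fin (n + 1) → α) := by
  rw [measurable_pi_iff]
  intro i
  refine Fin.lastCases ?_ (fun j => ?_) i
  · simpa using hf
  · simpa [Function.comp_def] using (measurable_pi_apply j).comp hg

lemma measurable_fin_take {α : Type*} [MeasurableSpace α] {n m : ℕ} (h : m ≤ n) :
    Measurable fun D : Fin n → α => (Fin.take m h D : Fin m → α) :=
  measurable_pi_iff.2 fun _ => measurable_pi_apply _

lemma sum_sum_ofReal_mul {S A : Type*} [Fintype S] [Fintype A] {π : S → A → ℝ} (hπ : IsPolicy π) {P : S → A → S → ℝ}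
    (hP : ∀ s a, P s a ∈ stdSimplex ℝ S) (s : S) :
    ∑ a, ∑ s', ENNReal.ofReal (π s a * P s a s') = 1 := by
  have h0 : ∀ a s', 0 ≤ π s a * P s a s' := fun a s' => mul_nonneg ((hπ s).1 a) ((hP s a).1 s')
  simp_rw [← ENNReal.ofReal_sum_of_nonneg fun s' _ => h0 _ s', ← Finset.mul_sum, (hP s _).2,
    mul_one]
  rw [← ENNReal.ofReal_sum_of_nonneg fun a _ => (hπ s).1 a, (hπ s).2, ENNReal.ofReal_one]

lemma measurable_cons_step {S A : Type*} [MeasurableSpace S] [MeasurableSpace A] {n : ℕ} (s : S) (a : A) (s' : S) :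
    Measurable fun x : ℝ × (Fin n → Step S A) =>
      (Fin.cons (s, a, x.1, s') x.2 : Fin (n + 1) → Step S A) :=
  measurable_fin_cons (by fun_prop) measurable_snd

lemma sum_mul_one_sub_div {ι : Type*} [Fintype ι] {p : ι → ℝ} (hp : p ∈ stdSimplex ℝ ι)
    (v : ι → ℝ) (r : ℝ) : ∑ i, p i * (1 - v i / r) = 1 - (∑ i, p i * v i) / r := by
  simp_rw [mul_sub, mul_one, Finset.sum_sub_distrib, hp.2, ← mul_div_assoc, ← Finset.sum_div]

/-- The inductive form of `exp(-X) ≤ 1 - X / (n + 1)` for `X ∈ [0, n]`, using `exp(-x) ≤ 1 / (1 +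
x)` for one step. -/
lemma exp_neg_mul_one_sub_le {x m : ℝ} {n : ℕ} (hx : x ∈ Set.Icc (0 : ℝ) 1)
    (hm : m ∈ Set.Icc (0 : ℝ) n) :
    Real.exp (-x) * (1 - m / (n + 1)) ≤ 1 - (x + m) / (n + 2) := by
  obtain ⟨hx0, hx1⟩ := hx
  obtain ⟨hm0, hmn⟩ := hm
  have h1 : Real.exp (-x) ≤ 1 / (1 + x) := by
    rw [Real.exp_neg, ← one_div]
    exact one_div_le_one_div_of_le (by linarith) (by linarith [Real.add_one_le_exp x])
  have hn : (0 : ℝ) ≤ n := Nat.cast_nonneg n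
  have h2 : 0 ≤ 1 - m / (n + 1) := by
    rw [sub_nonneg, div_le_one (by positivity)]
    linarith
  refine (mul_le_mul_of_nonneg_right h1 h2).trans ?_
  have e1 : 1 - m / ((n : ℝ) + 1) = (n + 1 - m) / (n + 1) := by field_simp
  have e2 : 1 - (x + m) / ((n : ℝ) + 2) = (n + 2 - x - m) / (n + 2) := by field_simp; ring
  rw [e1, e2, div_mul_div_comm, one_mul, div_le_div_iff₀ (by positivity) (by positivity)]
  have h3 : 0 ≤ x * (1 - x) := mul_nonneg hx0 (by linarith)
  have h4 : 0 ≤ x * (n - m) := mul_nonneg hx0 (by linarith)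
  nlinarith [mul_nonneg hn h3, mul_nonneg hn h4]

/-! ### Products of step weights along a trajectory. -/

section Rollout

variable {S A : Type*} [Fintype S] [Fintype A] [MeasurableSpace S] [MeasurableSpace A]

lemma isProbabilityMeasure_rollout {π : S → A → ℝ} (hπ : IsPolicy π) {P : S → A → S → ℝ}
    (hP : ∀ s a, P s a ∈ stdSimplex ℝ S) {L : S → A → Measure ℝ}
    (hL : ∀ s a, IsProbabilityMeasure (L s a)) (n : ℕ) (s : S) :
    IsProbabilityMeasure (rollout π P L n s) := by
  induction n generalizing s with
  | zero => rw [rollout]; infer_instance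
  | succ n ih =>
    refine ⟨?_⟩
    rw [rollout]
    simp only [Measure.coe_finsetSum, Measure.coe_smul, Finset.sum_apply, Pi.smul_apply,
      smul_eq_mul]
    rw [← sum_sum_ofReal_mul hπ hP s]
    refine Finset.sum_congr rfl fun a _ => Finset.sum_congr rfl fun s' _ => ?_
    have := ih s'
    rw [Measure.map_apply (measurable_cons_step s a s') MeasurableSet.univ, Set.preimage_univ,
      measure_univ, mul_one]

lemma lintegral_rollout_succ {π : S → A → ℝ} (hπ : IsPolicy π) {P : S → A → S → ℝ}
    (hP : ∀ s a, P s a ∈ stdSimplex ℝ S) {L : S → A → Measure ℝ}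
    (hL : ∀ s a, IsProbabilityMeasure (L s a)) {w : Step S A → ℝ≥0∞} (hw : Measurable w)
    (n : ℕ) (s : S) :
    ∫⁻ τ, ∏ h, w (τ h) ∂rollout π P L (n + 1) s
      = ∑ a, ∑ s', ENNReal.ofReal (π s a * P s a s') *
        ((∫⁻ l, w (s, a, l, s') ∂L s a) * ∫⁻ τ, ∏ h, w (τ h) ∂rollout π P L n s') := by
  have hmeas : ∀ n, Measurable fun τ : Fin n → Step S A => ∏ h, w (τ h) := fun n =>
    Finset.measurable_prod _ fun h _ => hw.comp (measurable_pi_apply h)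
  rw [rollout]
  simp only [lintegral_finsetSum_measure, lintegral_smul_measure, smul_eq_mul]
  refine Finset.sum_congr rfl fun a _ => Finset.sum_congr rfl fun s' _ => ?_
  have := isProbabilityMeasure_rollout hπ hP hL n s'
  rw [lintegral_map (hmeas _) (measurable_cons_step s a s')]
  simp only [Fin.prod_univ_succ, Fin.cons_zero, Fin.cons_succ]
  congr 1
  exact lintegral_prod_mul (μ := L s a) (f := fun l => w (s, a, l, s'))
    (g := fun τ : Fin n → Step S A => ∏ h, w (τ h))
    (hw.comp (by fun_prop)).aemeasurable (hmeas n).aemeasurable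

/-- A product of step weights whose conditional expectations are at most one has expectation at
most one. -/
lemma lintegral_rollout_prod_le_one {π : S → A → ℝ} (hπ : IsPolicy π) {P : S → A → S → ℝ}
    (hP : ∀ s a, P s a ∈ stdSimplex ℝ S) {L : S → A → Measure ℝ}
    (hL : ∀ s a, IsProbabilityMeasure (L s a)) {w : Step S A → ℝ≥0∞} (hw : Measurable w)
    (hw1 : ∀ s a, ∑ s', ENNReal.ofReal (P s a s') * ∫⁻ l, w (s, a, l, s') ∂L s a ≤ 1)
    (n : ℕ) (s : S) :
    ∫⁻ τ, ∏ h, w (τ h) ∂rollout π P L n s ≤ 1 := by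
  induction n generalizing s with
  | zero =>
    have := isProbabilityMeasure_rollout hπ hP hL 0 s
    simp
  | succ n ih =>
    rw [lintegral_rollout_succ hπ hP hL hw]
    calc _ ≤ ∑ a, ENNReal.ofReal (π s a) *
          ∑ s', ENNReal.ofReal (P s a s') * ∫⁻ l, w (s, a, l, s') ∂L s a := by
          refine Finset.sum_le_sum fun a _ => ?_
          rw [Finset.mul_sum]
          refine Finset.sum_le_sum fun s' _ => ?_
          rw [ENNReal.ofReal_mul ((hπ s).1 a), mul_assoc]
          gcongr
          exact mul_le_of_le_one_right' (ih s')
      _ ≤ ∑ a, ENNReal.ofReal (π s a) :=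
          Finset.sum_le_sum fun a _ => mul_le_of_le_one_right' (hw1 s a)
      _ = 1 := by
          rw [← ENNReal.ofReal_sum_of_nonneg fun a _ => (hπ s).1 a, (hπ s).2, ENNReal.ofReal_one]

/-- Peeling off one step turns the claim into `exp_neg_mul_one_sub_le`. The right side is affine in
the value to go, so averaging over actions and next states loses nothing. -/
lemma lintegral_rollout_prod_exp_le {π : S → A → ℝ} (hπ : IsPolicy π) {P : S → A → S → ℝ}
    (hP : ∀ s a, P s a ∈ stdSimplex ℝ S) {L : S → A → Measure ℝ}
    (hL : ∀ s a, IsProbabilityMeasure (L s a)) [DiscreteMeasurableSpace S]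
    [DiscreteMeasurableSpace A] {x : S → A → ℝ}
    (hx : ∀ s a, x s a ∈ Set.Icc (0 : ℝ) 1) (n : ℕ) (s : S) :
    ∫⁻ τ, ∏ h, ENNReal.ofReal (Real.exp (-x (τ h).1 (τ h).2.1)) ∂rollout π P L n s
      ≤ ENNReal.ofReal (1 - valRem π P x n s / (n + 1)) := by
  have hw : Measurable fun y : Step S A => ENNReal.ofReal (Real.exp (-x y.1 y.2.1)) := by
    have h1 : Measurable fun y : S × A => ENNReal.ofReal (Real.exp (-x y.1 y.2)) :=
      Measurable.of_discrete
    exact h1.comp (measurable_fst.prodMk (measurable_fst.comp measurable_snd))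
  induction n generalizing s with
  | zero =>
    have := isProbabilityMeasure_rollout hπ hP hL 0 s
    simp [valRem]
  | succ n ih =>
    rw [lintegral_rollout_succ hπ hP hL hw]
    have hv : ∀ s', valRem π P x n s' ∈ Set.Icc (0 : ℝ) n := valRem_mem_Icc hπ hP hx n
    have hn : (0 : ℝ) ≤ n := Nat.cast_nonneg n
    have hv' : ∀ s', 0 ≤ 1 - valRem π P x n s' / (n + 1) := fun s' => by
      rw [sub_nonneg, div_le_one (by positivity)]
      linarith [(hv s').2]
    calc _ ≤ ∑ a, ∑ s', ENNReal.ofReal (π s a * P s a s' *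
          (Real.exp (-x s a) * (1 - valRem π P x n s' / (n + 1)))) := by
          refine Finset.sum_le_sum fun a _ => Finset.sum_le_sum fun s' _ => ?_
          rw [ENNReal.ofReal_mul (mul_nonneg ((hπ s).1 a) ((hP s a).1 s')),
            ENNReal.ofReal_mul (Real.exp_pos _).le]
          have := hL s a
          simp only [lintegral_const, measure_univ, mul_one]
          gcongr
          exact ih s'
      _ = ENNReal.ofReal (∑ a, ∑ s', π s a * P s a s' *
          (Real.exp (-x s a) * (1 - valRem π P x n s' / (n + 1)))) := by
          have h0 : ∀ a s', 0 ≤ π s a * P s a s' *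
              (Real.exp (-x s a) * (1 - valRem π P x n s' / (n + 1))) := fun a s' =>
            mul_nonneg (mul_nonneg ((hπ s).1 a) ((hP s a).1 s'))
              (mul_nonneg (Real.exp_pos _).le (hv' s'))
          rw [ENNReal.ofReal_sum_of_nonneg fun a _ => Finset.sum_nonneg fun s' _ => h0 a s']
          simp_rw [ENNReal.ofReal_sum_of_nonneg fun s' _ => h0 _ s']
      _ ≤ _ := by
          refine ENNReal.ofReal_le_ofReal ?_
          have h1 : ∀ a, ∑ s', π s a * P s a s' *
              (Real.exp (-x s a) * (1 - valRem π P x n s' / (n + 1)))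
              = π s a * (Real.exp (-x s a) *
                (1 - (∑ s', P s a s' * valRem π P x n s') / (n + 1))) := by
            intro a
            calc _ = π s a * (Real.exp (-x s a) *
                  ∑ s', P s a s' * (1 - valRem π P x n s' / (n + 1))) := by
                  rw [Finset.mul_sum, Finset.mul_sum]
                  exact Finset.sum_congr rfl fun s' _ => by ring
              _ = _ := by
                  rw [sum_mul_one_sub_div (hP s a)]
          have h2 : ∀ a, π s a * (Real.exp (-x s a) *
                (1 - (∑ s', P s a s' * valRem π P x n s') / (n + 1)))
              ≤ π s a * (1 - (x s a + ∑ s', P s a s' * valRem π P x n s') / (n + 2)) := fun a =>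
            mul_le_mul_of_nonneg_left
              (exp_neg_mul_one_sub_le (hx s a) (sum_mul_mem_Icc (hP s a) hv)) ((hπ s).1 a)
          simp_rw [h1]
          refine (Finset.sum_le_sum fun a _ => h2 a).trans_eq ?_
          rw [sum_mul_one_sub_div (hπ s)]
          simp only [valRem]
          push_cast
          ring

lemma measurable_rollout {Ω : Type*} [MeasurableSpace Ω] {π : Ω → S → A → ℝ}
    (hπ : ∀ ω, IsPolicy (π ω)) (hπm : Measurable π) {P : S → A → S → ℝ}
    (hP : ∀ s a, P s a ∈ stdSimplex ℝ S) {L : S → A → Measure ℝ}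
    (hL : ∀ s a, IsProbabilityMeasure (L s a)) (n : ℕ) (s : S) :
    Measurable fun ω => rollout (π ω) P L n s := by
  induction n generalizing s with
  | zero => exact measurable_const
  | succ n ih =>
    refine Measure.measurable_of_measurable_coe _ fun B hB => ?_
    simp only [rollout, Measure.coe_finsetSum, Measure.coe_smul, Finset.sum_apply,
      Pi.smul_apply, smul_eq_mul]
    refine Finset.measurable_sum _ fun a _ => Finset.measurable_sum _ fun s' _ => ?_
    refine Measurable.mul ?_ ?_
    · have : Measurable fun ω => π ω s a :=
        (measurable_pi_apply a).comp ((measurable_pi_apply s).comp hπm)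
      fun_prop
    · have hκ : ∀ ω, IsProbabilityMeasure (rollout (π ω) P L n s') := fun ω =>
        isProbabilityMeasure_rollout (hπ ω) hP hL n s'
      have := hL s a
      -- As a kernel, the measurable dependence on `ω` passes to the product with the loss law.
      let κ : Kernel Ω (Fin n → Step S A) := ⟨fun ω => rollout (π ω) P L n s', ih s'⟩
      have : IsMarkovKernel κ := ⟨hκ⟩
      have h1 := (Kernel.const Ω (L s a) ×ₖ κ).measurable_coe (measurable_cons_step s a s' hB)
      simp_rw [Measure.map_apply (measurable_cons_step s a s') hB]
      simp only [Kernel.prod_apply, Kernel.const_apply] at h1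
      exact h1

end Rollout

/-! ### The law of one episode. -/

lemma CMDP.sum_ofReal_ctx {C S A : Type*} [Fintype C] [Fintype S] {H : ℕ}
    (M : CMDP C S A H) : ∑ c, ENNReal.ofReal (M.ctx c) = 1 := by
  rw [← ENNReal.ofReal_sum_of_nonneg fun c _ => M.ctx_mem.1 c, M.ctx_mem.2, ENNReal.ofReal_one]

/-- The expected cumulative score of one episode. -/
def CMDP.episodeValue {C S A : Type*} [Fintype C] [Fintype S] [Fintype A] {H : ℕ}
    (M : CMDP C S A H) (π : C → S → A → ℝ)
    (x : C → S → A → ℝ) : ℝ :=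
  ∑ c, M.ctx c * valRem (π c) (M.trans c) (x c) H M.start

section Episodes

variable {C S A : Type*} [Fintype C] [Fintype S] [Fintype A] [MeasurableSpace C]
  [MeasurableSpace S] [MeasurableSpace A] {H : ℕ}

lemma CMDP.isProbabilityMeasure_episodeLaw (M : CMDP C S A H) {π : C → S → A → ℝ}
    (hπ : ∀ c, IsPolicy (π c)) : IsProbabilityMeasure (M.episodeLaw π) := by
  refine ⟨?_⟩
  simp only [CMDP.episodeLaw, Measure.coe_finsetSum, Measure.coe_smul, Finset.sum_apply,
    Pi.smul_apply, smul_eq_mul]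
  rw [← M.sum_ofReal_ctx]
  refine Finset.sum_congr rfl fun c _ => ?_
  have := isProbabilityMeasure_rollout (hπ c) (M.trans_layered.1 c) (M.lossLaw_prob c) H M.start
  rw [Measure.map_apply measurable_prodMk_left MeasurableSet.univ, Set.preimage_univ,
    measure_univ, mul_one]

lemma CMDP.lintegral_episodeLaw (M : CMDP C S A H) (π : C → S → A → ℝ)
    {G : Episode C S A H → ℝ≥0∞} (hG : Measurable G) :
    ∫⁻ e, G e ∂M.episodeLaw π = ∑ c, ENNReal.ofReal (M.ctx c) *
      ∫⁻ τ, G (c, τ) ∂rollout (π c) (M.trans c) (M.lossLaw c) H M.start := by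
  simp only [CMDP.episodeLaw, lintegral_finsetSum_measure, lintegral_smul_measure, smul_eq_mul]
  refine Finset.sum_congr rfl fun c _ => ?_
  rw [lintegral_map hG measurable_prodMk_left]

lemma CMDP.measurable_episodeLaw (M : CMDP C S A H) {Ω : Type*} [MeasurableSpace Ω]
    {π : Ω → C → S → A → ℝ} (hπ : ∀ ω c, IsPolicy (π ω c)) (hπm : Measurable π) :
    Measurable fun ω => M.episodeLaw (π ω) := by
  refine Measure.measurable_of_measurable_coe _ fun B hB => ?_
  simp only [CMDP.episodeLaw, Measure.coe_finsetSum, Measure.coe_smul, Finset.sum_apply,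
    Pi.smul_apply, smul_eq_mul]
  refine Finset.measurable_sum _ fun c _ => Measurable.const_mul ?_ _
  simp_rw [Measure.map_apply measurable_prodMk_left hB]
  exact (Measure.measurable_coe (measurable_prodMk_left hB)).comp
    (measurable_rollout (fun ω => hπ ω c) ((measurable_pi_apply c).comp hπm)
      (M.trans_layered.1 c) (M.lossLaw_prob c) H M.start)

end Episodes

/-! ### Measurability of the algorithm in the data. -/

section Measurability

lemma measurable_qRem {Ω S A : Type*} [Fintype S] [Fintype A] [MeasurableSpace Ω]
    {lhat : Ω → S → A → ℝ} (hl : ∀ s a, Measurable fun ω => lhat ω s a)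
    {P : Ω → S → A → S → ℝ} (hP : ∀ s a s', Measurable fun ω => P ω s a s')
    {π : Ω → S → A → ℝ} (hπ : ∀ s a, Measurable fun ω => π ω s a) (n : ℕ) (s : S) (a : A) :
    Measurable fun ω => qRem (lhat ω) (P ω) (π ω) n s a := by
  induction n generalizing s a with
  | zero => exact measurable_const
  | succ n ih =>
    refine measurable_const.max ((hl s a).add (Finset.measurable_sum _ fun s' _ =>
      (hP s a s').mul (Finset.measurable_sum _ fun a' _ => (hπ s' a').mul (ih s' a'))))

lemma measurable_stateProb {Ω S A : Type*} [Fintype S] [Fintype A] [MeasurableSpace Ω]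
    [DecidableEq S] (s₁ : S)
    {P : Ω → S → A → S → ℝ} (hP : ∀ s a s', Measurable fun ω => P ω s a s')
    {π : Ω → S → A → ℝ} (hπ : ∀ s a, Measurable fun ω => π ω s a) (h : ℕ) (s : S) :
    Measurable fun ω => stateProb s₁ (π ω) (P ω) h s := by
  induction h generalizing s with
  | zero => exact measurable_const
  | succ h ih =>
    exact Finset.measurable_sum _ fun s' _ => Finset.measurable_sum _ fun a _ =>
      ((ih s').mul (hπ s' a)).mul (hP s' a s)

lemma measurable_valRem {Ω S A : Type*} [Fintype S] [Fintype A] [MeasurableSpace Ω]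
    (P : S → A → S → ℝ) (x : S → A → ℝ)
    {π : Ω → S → A → ℝ} (hπ : ∀ s a, Measurable fun ω => π ω s a) (n : ℕ) (s : S) :
    Measurable fun ω => valRem (π ω) P x n s := by
  induction n generalizing s with
  | zero => exact measurable_const
  | succ n ih =>
    exact Finset.measurable_sum _ fun a _ => (hπ s a).mul
      (measurable_const.add (Finset.measurable_sum _ fun s' _ => (ih s').const_mul _))

variable {C S A : Type*} [Fintype C] [Fintype S] [Fintype A] [DecidableEq S] {H : ℕ}

lemma measurable_bonus {Ω : Type*} [MeasurableSpace Ω] (M : CMDP C S A H) {n : ℕ} (β : ℝ)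
    {π : Ω → Fin n → S → A → ℝ} (hπ : ∀ i s a, Measurable fun ω => π ω i s a)
    {P : Ω → S → A → S → ℝ} (hP : ∀ s a s', Measurable fun ω => P ω s a s') (s : S) (a : A) :
    Measurable fun ω => bonus M β (π ω) (P ω) s a :=
  measurable_const.min (measurable_const.div (measurable_const.add
    (Finset.measurable_sum _ fun i _ => (measurable_stateProb _ hP (hπ i) _ s).mul (hπ i s a))))

variable [MeasurableSpace C] [MeasurableSpace S] [MeasurableSpace A]

lemma measurable_policy_apply (M : CMDP C S A H) (I : Input C S A H)
    (hloss : ∀ n, Measurable (I.lossOracle n)) (hdyn : ∀ n, Measurable (I.dynOracle n)) (n : ℕ)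
    (c : C) (s : S) (a : A) : Measurable fun D => policy M I n D c s a := by
  -- Strong induction, since the bonuses involve every earlier policy and not only the last.
  induction n using Nat.strong_induction_on generalizing s a with
  | _ n ih =>
    cases n with
    | zero =>
      simp only [policy]
      exact measurable_const
    | succ n =>
      have hl : ∀ s a, Measurable fun D => I.lossOracle n D c s a := fun s a =>
        (measurable_pi_apply a).comp ((measurable_pi_apply s).comp
          ((measurable_pi_apply c).comp (hloss n)))
      have hd : ∀ s a s', Measurable fun D => I.dynOracle n D c s a s' := fun s a s' =>
        (measurable_pi_apply s').comp ((measurable_pi_apply a).comp ((measurable_pi_apply s).comp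
          ((measurable_pi_apply c).comp (hdyn n))))
      have ht : Measurable fun D : Fin (n + 1) → Episode C S A H => Fin.take n n.le_succ D :=
        measurable_fin_take n.le_succ
      have hp : ∀ (i : Fin (n + 1)) s a, Measurable fun D : Fin (n + 1) → Episode C S A H =>
          policy M I i (Fin.take i i.isLt.le D) c s a := fun i s a =>
        (ih i i.isLt s a).comp (measurable_fin_take i.isLt.le)
      have hQ : ∀ h s a, Measurable fun D : Fin (n + 1) → Episode C S A H =>
          optQ M I (Fin.take n n.le_succ D) c
            (fun i : Fin (n + 1) => policy M I i (Fin.take i i.isLt.le D) c) h s a := by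
        intro h s a
        refine measurable_qRem (fun s a => ?_) (fun s a s' => (hd s a s').comp ht)
          (hp (Fin.last n)) _ _ _
        have hb := fun β => measurable_bonus M β (fun (i : Fin n) => hp i.castSucc)
          (fun s a s' => (hd s a s').comp ht) s a
        exact ((hl s a).comp ht).sub ((hb _).add ((hb _).const_mul _))
      simp only [policy, expWeights]
      have hn : ∀ a, Measurable fun D : Fin (n + 1) → Episode C S A H =>
          policy M I n (Fin.take n n.le_succ D) c s a := fun a =>
        (ih n (Nat.lt_succ_self n) s a).comp ht
      have he := fun a => (hn a).mul (((hQ (M.layer s) s a).const_mul (-I.η)).exp)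
      exact (he a).div (Finset.measurable_sum _ fun a' _ => he a')

lemma measurable_policy (M : CMDP C S A H) (I : Input C S A H)
    (hloss : ∀ n, Measurable (I.lossOracle n)) (hdyn : ∀ n, Measurable (I.dynOracle n)) (n : ℕ) :
    Measurable (policy M I n) :=
  measurable_pi_iff.2 fun c => measurable_pi_iff.2 fun s => measurable_pi_iff.2 fun a =>
    measurable_policy_apply M I hloss hdyn n c s a

end Measurability

/-! ### The law of the history and supermartingale products. -/

section History

variable {C S A : Type*} [Fintype C] [Fintype S] [Fintype A] [DecidableEq S]
  [MeasurableSpace C] [MeasurableSpace S] [MeasurableSpace A] {H : ℕ}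

lemma isProbabilityMeasure_historyLaw [Nonempty A] (M : CMDP C S A H) (I : Input C S A H)
    (hloss : ∀ n, Measurable (I.lossOracle n)) (hdyn : ∀ n, Measurable (I.dynOracle n)) (n : ℕ) :
    IsProbabilityMeasure (historyLaw M I n) := by
  induction n with
  | zero => rw [historyLaw]; infer_instance
  | succ n ih =>
    rw [historyLaw]
    have hE : ∀ D, IsProbabilityMeasure (M.episodeLaw (policy M I n D)) := fun D =>
      M.isProbabilityMeasure_episodeLaw (isPolicy_policy M I n D)
    let κ : Kernel (Fin n → Episode C S A H) (Episode C S A H) :=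
      ⟨fun D => M.episodeLaw (policy M I n D),
        M.measurable_episodeLaw (isPolicy_policy M I n) (measurable_policy M I hloss hdyn n)⟩
    have : IsMarkovKernel κ := ⟨hE⟩
    have hsn : Measurable fun p : (Fin n → Episode C S A H) × Episode C S A H =>
        (Fin.snoc p.1 p.2 : Fin (n + 1) → Episode C S A H) :=
      measurable_fin_snoc measurable_snd measurable_fst
    have h1 : ∀ D, ((Kernel.id ×ₖ κ).map fun p =>
        (Fin.snoc p.1 p.2 : Fin (n + 1) → Episode C S A H)) D
        = (M.episodeLaw (policy M I n D)).map fun e => Fin.snoc D e := fun D => by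
      rw [Kernel.map_apply _ hsn, Kernel.prod_apply, Kernel.id_apply, Measure.dirac_prod,
        Measure.map_map hsn measurable_prodMk_left]
      rfl
    refine isProbabilityMeasure_bind (Measurable.aemeasurable ?_) (.of_forall fun D => ?_)
    · simp_rw [← h1]
      exact Kernel.measurable _
    · exact Measure.isProbabilityMeasure_map
        (measurable_fin_snoc measurable_id measurable_const).aemeasurable

/-- The product is a nonnegative supermartingale: integrate out the last episode, conditionally on
the past. -/
lemma lintegral_historyLaw_prod_le_one (M : CMDP C S A H) (I : Input C S A H)
    {K : (i : ℕ) → (Fin i → Episode C S A H) → Episode C S A H → ℝ≥0∞}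
    (hK : ∀ i D, Measurable (K i D))
    (hK1 : ∀ i D, ∫⁻ e, K i D e ∂M.episodeLaw (policy M I i D) ≤ 1) (n : ℕ) :
    ∫⁻ D, ∏ i : Fin n, K i (Fin.take i i.isLt.le D) (D i) ∂historyLaw M I n ≤ 1 := by
  induction n with
  | zero => simp [historyLaw]
  | succ n ih =>
    rw [historyLaw]
    -- The inequality forms for `bind` and `map` suffice, so the kernels and `K` need no joint
    -- measurability here.
    refine (Measure.lintegral_bind_le _ _ _).trans (le_trans (lintegral_mono fun D => ?_) ih)
    refine (lintegral_map_le _ _).trans ?_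
    have h1 : ∀ e, ∏ i : Fin (n + 1), K i
        (Fin.take i i.isLt.le (Fin.snoc D e : Fin (n + 1) → Episode C S A H))
        ((Fin.snoc D e : Fin (n + 1) → Episode C S A H) i)
        = (∏ i : Fin n, K i (Fin.take i i.isLt.le D) (D i)) * K n D e := by
      intro e
      rw [Fin.prod_univ_castSucc]
      have h2 : ∀ m (hm : m ≤ n), (Fin.take m (hm.trans n.le_succ)
          (Fin.snoc D e : Fin (n + 1) → Episode C S A H) : Fin m → Episode C S A H)
          = Fin.take m hm D := fun m hm => by
        funext j
        exact Fin.snoc_castSucc (α := fun _ => Episode C S A H) e D (Fin.castLE hm j)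
      congr 1
      · refine Finset.prod_congr rfl fun i _ => ?_
        rw [Fin.snoc_castSucc]
        congr 1
        exact h2 i i.isLt.le
      · rw [Fin.snoc_last]
        congr 1
        exact h2 n le_rfl
    simp_rw [h1]
    rw [lintegral_const_mul _ (hK n D)]
    exact mul_le_of_le_one_right' (hK1 n D)

end History

/-- Setting weights to one from round `t` on expresses statements about the first `t` episodes under
the law of all `T`. -/
lemma prod_fin_ite_lt {α : Type*} [CommMonoid α] {t T : ℕ} (h : t ≤ T) (g : Fin T → α) :
    ∏ i : Fin T, (if (i : ℕ) < t then g i else 1) = ∏ j : Fin t, g (Fin.castLE h j) := by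
  rw [← Finset.prod_filter]
  have : Finset.univ.filter (fun i : Fin T => (i : ℕ) < t)
      = Finset.univ.map (Fin.castLEEmb h) := by
    ext i
    simp only [Finset.mem_filter, Finset.mem_univ, true_and, Finset.mem_map, Fin.coe_castLEEmb]
    exact ⟨fun hi => ⟨⟨i, hi⟩, rfl⟩, fun ⟨j, hj⟩ => hj ▸ j.isLt⟩
  rw [this, Finset.prod_map]
  rfl

/-! ### Episode weights with mean at most one. -/

section EpisodeWeights

variable {C S A : Type*} [Fintype C] [Fintype S] [Fintype A]
  [MeasurableSpace C] [MeasurableSpace S] [MeasurableSpace A] {H : ℕ}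

lemma lintegral_episodeLaw_prod_le_one (M : CMDP C S A H) {π : C → S → A → ℝ}
    (hπ : ∀ c, IsPolicy (π c)) {w : C × Step S A → ℝ≥0∞} (hw : Measurable w)
    (hw1 : ∀ c s a, ∑ s', ENNReal.ofReal (M.trans c s a s') *
      ∫⁻ l, w (c, s, a, l, s') ∂M.lossLaw c s a ≤ 1) :
    ∫⁻ e, ∏ h, w (e.1, e.2 h) ∂M.episodeLaw π ≤ 1 := by
  rw [M.lintegral_episodeLaw π (Finset.measurable_prod _ fun h _ => by fun_prop),
    ← M.sum_ofReal_ctx]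
  refine Finset.sum_le_sum fun c _ => mul_le_of_le_one_right' ?_
  exact lintegral_rollout_prod_le_one (hπ c) (M.trans_layered.1 c) (M.lossLaw_prob c)
    (w := fun y => w (c, y)) (hw.comp measurable_prodMk_left) (hw1 c) H M.start

variable [DiscreteMeasurableSpace C] [DiscreteMeasurableSpace S] [DiscreteMeasurableSpace A]

lemma lintegral_episodeLaw_prod_exp_le_one (M : CMDP C S A H) {π : C → S → A → ℝ}
    (hπ : ∀ c, IsPolicy (π c)) {x : C → S → A → ℝ}
    (hx : ∀ c s a, x c s a ∈ Set.Icc (0 : ℝ) 1) :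
    ∫⁻ e, (∏ h, ENNReal.ofReal (Real.exp (-x e.1 (e.2 h).1 (e.2 h).2.1)))
      * ENNReal.ofReal (Real.exp (M.episodeValue π x / (H + 1))) ∂M.episodeLaw π ≤ 1 := by
  have hm : Measurable fun y : C × S × A => ENNReal.ofReal (Real.exp (-x y.1 y.2.1 y.2.2)) :=
    Measurable.of_discrete
  have hm2 : Measurable fun e : Episode C S A H =>
      ∏ h, ENNReal.ofReal (Real.exp (-x e.1 (e.2 h).1 (e.2 h).2.1)) :=
    Finset.measurable_prod _ fun h _ =>
      hm.comp (g := fun y : C × S × A => ENNReal.ofReal (Real.exp (-x y.1 y.2.1 y.2.2)))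
        (f := fun e : Episode C S A H => (e.1, (e.2 h).1, (e.2 h).2.1)) (by fun_prop)
  rw [lintegral_mul_const _ hm2, M.lintegral_episodeLaw π hm2]
  have hv : ∀ c, 0 ≤ 1 - valRem (π c) (M.trans c) (x c) H M.start / (H + 1) := fun c => by
    have := valRem_mem_Icc (hπ c) (M.trans_layered.1 c) (hx c) H M.start
    rw [sub_nonneg, div_le_one (by positivity)]
    linarith [this.2]
  have h1 : ∑ c, ENNReal.ofReal (M.ctx c) *
      ∫⁻ τ, ∏ h, ENNReal.ofReal (Real.exp (-x c (τ h).1 (τ h).2.1))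
        ∂rollout (π c) (M.trans c) (M.lossLaw c) H M.start
      ≤ ENNReal.ofReal (1 - M.episodeValue π x / (H + 1)) := by
    calc _ ≤ ∑ c, ENNReal.ofReal (M.ctx c *
          (1 - valRem (π c) (M.trans c) (x c) H M.start / (H + 1))) := by
          refine Finset.sum_le_sum fun c _ => ?_
          rw [ENNReal.ofReal_mul (M.ctx_mem.1 c)]
          gcongr
          exact lintegral_rollout_prod_exp_le (hπ c) (M.trans_layered.1 c) (M.lossLaw_prob c)
            (hx c) H M.start
      _ = _ := by
          rw [← ENNReal.ofReal_sum_of_nonneg fun c _ => mul_nonneg (M.ctx_mem.1 c) (hv c)]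
          congr 1
          exact sum_mul_one_sub_div M.ctx_mem _ _
  refine (mul_le_mul_left h1 _).trans ?_
  rw [← ENNReal.ofReal_mul' (Real.exp_pos _).le, ENNReal.ofReal_le_one]
  have h2 := Real.add_one_le_exp (-(M.episodeValue π x / (H + 1)))
  calc _ ≤ Real.exp (-(M.episodeValue π x / (H + 1))) *
        Real.exp (M.episodeValue π x / (H + 1)) :=
        mul_le_mul_of_nonneg_right (by linarith) (Real.exp_pos _).le
    _ = 1 := by rw [← Real.exp_add, neg_add_cancel, Real.exp_zero]

end EpisodeWeights

lemma two_mul_le_exp_add_exp {L a b : ℝ} (hL : 0 < L) (h : 2 * Real.log L ≤ a + b) :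
    2 * L ≤ Real.exp a + Real.exp b := by
  have h1 : L ≤ Real.exp (a / 2) * Real.exp (b / 2) := by
    rw [← Real.exp_add, ← Real.log_le_iff_le_exp hL]
    linarith
  have h2 : ∀ y, Real.exp y = Real.exp (y / 2) ^ 2 := fun y => by
    rw [← Real.exp_nat_mul]
    congr 1
    push_cast
    ring
  rw [h2 a, h2 b]
  nlinarith [sq_nonneg (Real.exp (a / 2) - Real.exp (b / 2))]

/-! ### From realised to expected scores. -/

section Concentration

variable {C S A : Type*} [Fintype C] [Fintype S] [Fintype A] [DecidableEq S]
  [MeasurableSpace C] [MeasurableSpace S] [MeasurableSpace A] {H : ℕ}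

lemma historyLaw_prod_add_prod_ge_le (M : CMDP C S A H) (I : Input C S A H)
    {K₁ K₂ : (i : ℕ) → (Fin i → Episode C S A H) → Episode C S A H → ℝ≥0∞}
    (hm1 : ∀ i, Measurable fun p : (Fin i → Episode C S A H) × Episode C S A H => K₁ i p.1 p.2)
    (hm2 : ∀ i, Measurable fun p : (Fin i → Episode C S A H) × Episode C S A H => K₂ i p.1 p.2)
    (hi1 : ∀ i D, ∫⁻ e, K₁ i D e ∂M.episodeLaw (policy M I i D) ≤ 1)
    (hi2 : ∀ i D, ∫⁻ e, K₂ i D e ∂M.episodeLaw (policy M I i D) ≤ 1)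
    (T : ℕ) {L : ℝ} (hL : 0 < L) :
    historyLaw M I T {D | ENNReal.ofReal (2 * L) ≤
      ∏ i : Fin T, K₁ i (Fin.take i i.isLt.le D) (D i)
        + ∏ i : Fin T, K₂ i (Fin.take i i.isLt.le D) (D i)} ≤ ENNReal.ofReal (1 / L) := by
  have hM1 := lintegral_historyLaw_prod_le_one M I (K := K₁)
    (fun i D => (hm1 i).comp (measurable_prodMk_left (x := D))) hi1 T
  have hM2 := lintegral_historyLaw_prod_le_one M I (K := K₂)
    (fun i D => (hm2 i).comp (measurable_prodMk_left (x := D))) hi2 T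
  have hmZ : ∀ K : (i : ℕ) → (Fin i → Episode C S A H) → Episode C S A H → ℝ≥0∞,
      (∀ i, Measurable fun p : (Fin i → Episode C S A H) × Episode C S A H => K i p.1 p.2) →
      Measurable fun D : Fin T → Episode C S A H =>
        ∏ i : Fin T, K i (Fin.take i i.isLt.le D) (D i) := fun K hK =>
    Finset.measurable_prod _ fun i _ =>
      (hK i).comp ((measurable_fin_take i.isLt.le).prodMk (measurable_pi_apply i))
  have hZ := (hmZ K₁ hm1).add (hmZ K₂ hm2)
  refine (meas_ge_le_lintegral_div hZ.aemeasurable (by simpa using hL)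
    ENNReal.ofReal_ne_top).trans ?_
  calc _ ≤ 2 / ENNReal.ofReal (2 * L) := by
        gcongr
        simp only [Pi.add_apply]
        rw [lintegral_add_left (hmZ K₁ hm1), ← one_add_one_eq_two]
        exact add_le_add hM1 hM2
    _ = ENNReal.ofReal (1 / L) := by
        have : (2 : ℝ≥0∞) = ENNReal.ofReal 2 := by simp
        rw [this, ← ENNReal.ofReal_div_of_pos (by positivity)]
        congr 1
        field_simp

variable [Nonempty A] [DiscreteMeasurableSpace C] [DiscreteMeasurableSpace S]
  [DiscreteMeasurableSpace A]

/-- If the realised cumulative score is dominated by a product of weights with conditional means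
at most one, then the expected cumulative score is small. -/
lemma historyLaw_episodeValue_ge_le (M : CMDP C S A H) (I : Input C S A H)
    (hloss : ∀ n, Measurable (I.lossOracle n)) (hdyn : ∀ n, Measurable (I.dynOracle n))
    {x : C → S → A → ℝ} (hx : ∀ c s a, x c s a ∈ Set.Icc (0 : ℝ) 1)
    {w : C × Step S A → ℝ≥0∞} (hw : Measurable w)
    (hw1 : ∀ c s a, ∑ s', ENNReal.ofReal (M.trans c s a s') *
      ∫⁻ l, w (c, s, a, l, s') ∂M.lossLaw c s a ≤ 1)
    {t T : ℕ} (ht : t ≤ T) {L : ℝ} (hL : 0 < L) :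
    historyLaw M I T {D |
      ENNReal.ofReal (Real.exp (∑ i : Fin t, ∑ h,
          x (Fin.take t ht D i).1 ((Fin.take t ht D i).2 h).1 ((Fin.take t ht D i).2 h).2.1))
        ≤ ∏ i : Fin t, ∏ h, w ((Fin.take t ht D i).1, (Fin.take t ht D i).2 h) ∧
      2 * (H + 1) * Real.log L ≤ ∑ i : Fin t,
        M.episodeValue (policy M I i (Fin.take i i.isLt.le (Fin.take t ht D))) x}
      ≤ ENNReal.ofReal (1 / L) := by
  let W : Episode C S A H → ℝ≥0∞ := fun e => ∏ h, w (e.1, e.2 h)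
  let E : (i : ℕ) → (Fin i → Episode C S A H) → Episode C S A H → ℝ≥0∞ := fun i D e =>
    (∏ h, ENNReal.ofReal (Real.exp (-x e.1 (e.2 h).1 (e.2 h).2.1)))
      * ENNReal.ofReal (Real.exp (M.episodeValue (policy M I i D) x / (H + 1)))
  have hEp : ∀ i D, IsProbabilityMeasure (M.episodeLaw (policy M I i D)) := fun i D =>
    M.isProbabilityMeasure_episodeLaw (isPolicy_policy M I i D)
  have hmx : Measurable fun y : C × S × A => ENNReal.ofReal (Real.exp (-x y.1 y.2.1 y.2.2)) :=
    Measurable.of_discrete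
  have hWm : Measurable W := Finset.measurable_prod _ fun h _ => by fun_prop
  have hEm : ∀ i, Measurable fun p : (Fin i → Episode C S A H) × Episode C S A H =>
      E i p.1 p.2 := fun i => by
    refine Measurable.mul (Finset.measurable_prod _ fun h _ => ?_) ?_
    · exact hmx.comp (g := fun y : C × S × A => ENNReal.ofReal (Real.exp (-x y.1 y.2.1 y.2.2)))
        (f := fun e : (Fin i → Episode C S A H) × Episode C S A H =>
          (e.2.1, (e.2.2 h).1, (e.2.2 h).2.1)) (by fun_prop)
    · have : Measurable fun D => M.episodeValue (policy M I i D) x :=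
        Finset.measurable_sum _ fun c _ => (measurable_valRem _ _
          (fun s a => measurable_policy_apply M I hloss hdyn i c s a) _ _).const_mul _
      exact (((this.comp measurable_fst).div_const _).exp).ennreal_ofReal
  refine le_trans (measure_mono fun D hD => ?_) (historyLaw_prod_add_prod_ge_le M I
    (K₁ := fun i _ e => if i < t then W e else 1)
    (K₂ := fun i D e => if i < t then E i D e else 1) (fun i => ?_) (fun i => ?_)
    (fun i D => ?_) (fun i D => ?_) T hL)
  · obtain ⟨h1, h2⟩ := hD
    rw [Set.mem_ofPred_eq, prod_fin_ite_lt ht (fun i => W (D i)),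
      prod_fin_ite_lt ht (fun i => E i (Fin.take i i.isLt.le D) (D i))]
    -- With `S` the realised and `E` the expected score, the products are at least `exp S` and equal
    -- to `exp(-S + E/(H+1))`. The exponents add up to `E/(H+1) ≥ 2 log L` whatever `S` is.
    refine le_trans ?_ (add_le_add_left h1 _)
    have h3 : ∏ j : Fin t, E (Fin.castLE ht j)
          (Fin.take (Fin.castLE ht j) (Fin.castLE ht j).isLt.le D) (D (Fin.castLE ht j))
        = ENNReal.ofReal (Real.exp (-(∑ i : Fin t, ∑ h,
          x (Fin.take t ht D i).1 ((Fin.take t ht D i).2 h).1 ((Fin.take t ht D i).2 h).2.1)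
          + (∑ i : Fin t, M.episodeValue
            (policy M I i (Fin.take i i.isLt.le (Fin.take t ht D))) x) / (H + 1))) := by
      rw [← Finset.sum_neg_distrib, Finset.sum_div, ← Finset.sum_add_distrib, Real.exp_sum,
        ENNReal.ofReal_prod_of_nonneg fun _ _ => (Real.exp_pos _).le]
      refine Finset.prod_congr rfl fun j _ => ?_
      rw [Real.exp_add, ENNReal.ofReal_mul (Real.exp_pos _).le, ← Finset.sum_neg_distrib,
        Real.exp_sum, ENNReal.ofReal_prod_of_nonneg fun _ _ => (Real.exp_pos _).le]
      rfl
    rw [h3, ← ENNReal.ofReal_add (Real.exp_pos _).le (Real.exp_pos _).le]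
    refine ENNReal.ofReal_le_ofReal (two_mul_le_exp_add_exp hL ?_)
    rw [add_neg_cancel_left, le_div_iff₀ (by positivity)]
    linarith
  · by_cases h : i < t
    · simp only [h, if_true]
      exact hWm.comp measurable_snd
    · simp only [h, if_false]
      exact measurable_const
  · by_cases h : i < t
    · simpa only [h, if_true] using hEm i
    · simp only [h, if_false]
      exact measurable_const
  · by_cases h : i < t
    · simp only [h, if_true]
      exact lintegral_episodeLaw_prod_le_one M (isPolicy_policy M I i D) hw hw1
    · simp [h]
  · by_cases h : i < t
    · simp only [h, if_true]
      exact lintegral_episodeLaw_prod_exp_le_one M (isPolicy_policy M I i D) hx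
    · simp [h]

end Concentration

/-! ### Hoeffding and likelihood-ratio weights. -/

section Weights

/-- Hoeffding's lemma: variance proxy `1/4` at parameter `2g` gives `exp(g²/2)`. With `g = f - ℓ⋆`
the squared-error gain of `f` over `ℓ⋆` is `2g(l - ℓ⋆) - g²`, so the exponent here is that gain plus
the score `g²/2`. -/
lemma lintegral_exp_hoeffding_le_one {μ : Measure ℝ} [IsProbabilityMeasure μ]
    (hμ : μ (Set.Icc 0 1)ᶜ = 0) (g : ℝ) :
    ∫⁻ l, ENNReal.ofReal (Real.exp (2 * g * (l - ∫ x, x ∂μ) - g ^ 2 / 2)) ∂μ ≤ 1 := by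
  have hb : ∀ᵐ l ∂μ, l ∈ Set.Icc (0 : ℝ) 1 := hμ
  have h := hasSubgaussianMGF_of_mem_Icc (X := fun l : ℝ => l) (μ := μ)
    measurable_id.aemeasurable hb
  have h1 := h.mgf_le (2 * g)
  have hi := h.integrable_exp_mul (2 * g)
  have h2 : ∀ l : ℝ, ENNReal.ofReal (Real.exp (2 * g * (l - ∫ x, x ∂μ) - g ^ 2 / 2))
      = ENNReal.ofReal (Real.exp (-(g ^ 2 / 2))) *
        ENNReal.ofReal (Real.exp (2 * g * (l - ∫ x, x ∂μ))) := fun l => by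
    rw [← ENNReal.ofReal_mul (Real.exp_pos _).le, ← Real.exp_add]
    congr 2
    ring
  simp_rw [h2]
  rw [lintegral_const_mul' _ _ ENNReal.ofReal_ne_top,
    ← ofReal_integral_eq_lintegral_ofReal hi (.of_forall fun _ => (Real.exp_pos _).le),
    ← ENNReal.ofReal_mul (Real.exp_pos _).le, ENNReal.ofReal_le_one]
  refine (mul_le_mul_of_nonneg_left h1 (Real.exp_pos _).le).trans ?_
  rw [← Real.exp_add, Real.exp_le_one_iff]
  simp
  ring_nf
  rfl

/-- The square-root likelihood ratio, compensated by the squared Hellinger distance, has mean at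
most one. -/
lemma sum_mul_sqrt_div_mul_exp_le_one {S : Type*} [Fintype S] {p q : S → ℝ}
    (hp : p ∈ stdSimplex ℝ S) (hq : q ∈ stdSimplex ℝ S) :
    ∑ s, q s * (√(p s / q s) * Real.exp (hel p q / 2)) ≤ 1 := by
  have h1 : ∀ s, q s * (√(p s / q s) * Real.exp (hel p q / 2))
      = √(p s) * √(q s) * Real.exp (hel p q / 2) := fun s => by
    rw [Real.sqrt_div (hp.1 s), ← mul_assoc]
    congr 1
    rw [mul_div_assoc', mul_comm (q s), mul_div_assoc, Real.div_sqrt]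
  simp_rw [h1]
  rw [← Finset.sum_mul]
  have h2 : ∑ s, √(p s) * √(q s) = 1 - hel p q / 2 := by
    rw [hel_eq hp hq]
    ring
  rw [h2]
  have h3 := Real.add_one_le_exp (-(hel p q / 2))
  calc _ ≤ Real.exp (-(hel p q / 2)) * Real.exp (hel p q / 2) :=
        mul_le_mul_of_nonneg_right (by linarith) (Real.exp_pos _).le
    _ = 1 := by rw [← Real.exp_add, neg_add_cancel, Real.exp_zero]

lemma ennreal_log_prod {ι : Type*} (s : Finset ι) (f : ι → ℝ≥0∞) :
    ENNReal.log (∏ i ∈ s, f i) = ∑ i ∈ s, ENNReal.log (f i) := by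
  classical
  induction s using Finset.induction_on with
  | empty => simp
  | insert a s ha ih => rw [Finset.prod_insert ha, Finset.sum_insert ha, ENNReal.log_mul_add, ih]

variable {C S A : Type*} {H : ℕ}

/-- Passing to products replaces the value `-∞` by `0`, so that likelihoods can be compared in the
reals. -/
lemma prod_le_prod_of_logLik_le {n : ℕ} {P Q : C → S → A → S → ℝ}
    (hP : ∀ c s a s', 0 ≤ P c s a s') (hQ : ∀ c s a s', 0 ≤ Q c s a s')
    {D : Fin n → Episode C S A H} (h : logLik Q D ≤ logLik P D) :
    ∏ i, ∏ h, Q (D i).1 ((D i).2 h).1 ((D i).2 h).2.1 ((D i).2 h).2.2.2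
      ≤ ∏ i, ∏ h, P (D i).1 ((D i).2 h).1 ((D i).2 h).2.1 ((D i).2 h).2.2.2 := by
  have key : ∀ R : C → S → A → S → ℝ, (∀ c s a s', 0 ≤ R c s a s') → logLik R D
      = ENNReal.log (ENNReal.ofReal
        (∏ i, ∏ h, R (D i).1 ((D i).2 h).1 ((D i).2 h).2.1 ((D i).2 h).2.2.2)) := by
    intro R hR
    rw [ENNReal.ofReal_prod_of_nonneg fun i _ => Finset.prod_nonneg fun h _ => hR _ _ _ _,
      ennreal_log_prod]
    refine Finset.sum_congr rfl fun i _ => ?_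
    rw [ENNReal.ofReal_prod_of_nonneg fun h _ => hR _ _ _ _, ennreal_log_prod]
  rw [key Q hQ, key P hP, ENNReal.log_le_log_iff] at h
  exact (ENNReal.ofReal_le_ofReal_iff
    (Finset.prod_nonneg fun i _ => Finset.prod_nonneg fun h _ => hP _ _ _ _)).1 h

end Weights

lemma measurable_discrete_step {C S A E : Type*} [Finite C] [Finite S] [Finite A]
    [MeasurableSpace C] [MeasurableSpace S] [MeasurableSpace A]
    [DiscreteMeasurableSpace C] [DiscreteMeasurableSpace S] [DiscreteMeasurableSpace A]
    [MeasurableSpace E] (f : C → S → A → S → E) :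
    Measurable fun y : C × Step S A => f y.1 y.2.1 y.2.2.1 y.2.2.2.2 := by
  have h : Measurable fun y : C × S × A × S => f y.1 y.2.1 y.2.2.1 y.2.2.2 :=
    Measurable.of_discrete
  exact h.comp (g := fun y : C × S × A × S => f y.1 y.2.1 y.2.2.1 y.2.2.2)
    (f := fun y : C × Step S A => (y.1, y.2.1, y.2.2.1, y.2.2.2.2)) (by fun_prop)

/-! ### Accuracy of a fixed candidate that fits the data. -/

section Estimation

variable {C S A : Type*} [Fintype C] [Fintype S] [Fintype A] [DecidableEq S]
  [MeasurableSpace C] [MeasurableSpace S] [MeasurableSpace A]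
  [DiscreteMeasurableSpace C] [DiscreteMeasurableSpace S]
  [DiscreteMeasurableSpace A] {H : ℕ}

variable [Nonempty A] (M : CMDP C S A H) (I : Input C S A H)

/-- Almost surely, only transitions of positive probability are observed. -/
lemma ae_historyLaw_trans_ne_zero (T : ℕ) : ∀ᵐ D ∂historyLaw M I T, ∀ (i : Fin T) h,
    M.trans (D i).1 ((D i).2 h).1 ((D i).2 h).2.1 ((D i).2 h).2.2.2 ≠ 0 := by
  classical
  -- Since `0 * ⊤ = 0`, an infinite weight on impossible transitions leaves the mean at one; a
  -- product with finite mean is almost surely finite.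
  let w : C × Step S A → ℝ≥0∞ := fun y =>
    if M.trans y.1 y.2.1 y.2.2.1 y.2.2.2.2 = 0 then ⊤ else 1
  have hw : Measurable w :=
    measurable_discrete_step fun c s a s' => if M.trans c s a s' = 0 then ⊤ else 1
  have hw0 : ∀ y, w y ≠ 0 := fun y => by
    simp only [w]
    split_ifs <;> simp
  have hW : Measurable fun e : Episode C S A H => ∏ h, w (e.1, e.2 h) :=
    Finset.measurable_prod _ fun h _ => by fun_prop
  have h1 := lintegral_historyLaw_prod_le_one M I
    (K := fun _ _ (e : Episode C S A H) => ∏ h, w (e.1, e.2 h)) (fun _ _ => hW)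
    (fun i D => lintegral_episodeLaw_prod_le_one M (isPolicy_policy M I i D) hw
      fun c s a => by
        have hL := M.lossLaw_prob c s a
        have : ∀ s', ENNReal.ofReal (M.trans c s a s') *
            ∫⁻ l, w (c, s, a, l, s') ∂M.lossLaw c s a = ENNReal.ofReal (M.trans c s a s') := by
          intro s'
          by_cases h : M.trans c s a s' = 0
          · simp [h]
          · simp [w, h]
        simp_rw [this]
        rw [← ENNReal.ofReal_sum_of_nonneg fun s' _ => (M.trans_layered.1 c s a).1 s',
          (M.trans_layered.1 c s a).2, ENNReal.ofReal_one]) T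
  have h2 := ae_lt_top (Finset.measurable_prod _ fun i _ => hW.comp (measurable_pi_apply i))
    (h1.trans_lt ENNReal.one_lt_top).ne
  filter_upwards [h2] with D hD i h h0
  refine hD.ne ?_
  simp only [Function.comp_apply] at hD ⊢
  rw [← Finset.mul_prod_erase _ _ (Finset.mem_univ i),
    ← Finset.mul_prod_erase _ _ (Finset.mem_univ h)]
  have : w ((D i).1, (D i).2 h) = ⊤ := by simp [w, h0]
  rw [this, ENNReal.top_mul, ENNReal.top_mul]
  · exact Finset.prod_ne_zero_iff.2 fun i _ => Finset.prod_ne_zero_iff.2 fun h _ => hw0 _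
  · exact Finset.prod_ne_zero_iff.2 fun h _ => hw0 _

/-- A dynamics at least as likely as the true one on the data of `t` episodes is close to it in
expected Hellinger distance. -/
lemma historyLaw_logLik_le
    (hloss : ∀ n, Measurable (I.lossOracle n)) (hdyn : ∀ n, Measurable (I.dynOracle n))
    {P : C → S → A → S → ℝ}
    (hP : ∀ c s a, P c s a ∈ stdSimplex ℝ S) {t T : ℕ} (ht : t ≤ T) {L : ℝ} (hL : 0 < L) :
    historyLaw M I T {D | logLik M.trans (Fin.take t ht D) ≤ logLik P (Fin.take t ht D) ∧
      2 * (H + 1) * Real.log L ≤ ∑ i : Fin t,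
        M.episodeValue (policy M I i (Fin.take i i.isLt.le (Fin.take t ht D)))
          fun c s a => hel (P c s a) (M.trans c s a) / 2}
      ≤ ENNReal.ofReal (1 / L) := by
  have hQ := M.trans_layered.1
  have hx : ∀ c s a, hel (P c s a) (M.trans c s a) / 2 ∈ Set.Icc (0 : ℝ) 1 := fun c s a => by
    have h1 := hel_nonneg (P c s a) (M.trans c s a)
    have h2 := hel_le_two (hP c s a) (hQ c s a)
    constructor <;> linarith
  let w : C × Step S A → ℝ≥0∞ := fun y => ENNReal.ofReal
    (√(P y.1 y.2.1 y.2.2.1 y.2.2.2.2 / M.trans y.1 y.2.1 y.2.2.1 y.2.2.2.2)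
      * Real.exp (hel (P y.1 y.2.1 y.2.2.1) (M.trans y.1 y.2.1 y.2.2.1) / 2))
  have hw : Measurable w := measurable_discrete_step fun c s a s' => ENNReal.ofReal
    (√(P c s a s' / M.trans c s a s') * Real.exp (hel (P c s a) (M.trans c s a) / 2))
  have hw1 : ∀ c s a, ∑ s', ENNReal.ofReal (M.trans c s a s') *
      ∫⁻ l, w (c, s, a, l, s') ∂M.lossLaw c s a ≤ 1 := fun c s a => by
    have hL := M.lossLaw_prob c s a
    simp only [w, lintegral_const, measure_univ, mul_one]
    simp_rw [← ENNReal.ofReal_mul ((hQ c s a).1 _)]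
    rw [← ENNReal.ofReal_sum_of_nonneg fun s' _ => mul_nonneg ((hQ c s a).1 s')
      (mul_nonneg (Real.sqrt_nonneg _) (Real.exp_pos _).le), ENNReal.ofReal_le_one]
    exact sum_mul_sqrt_div_mul_exp_le_one (hP c s a) (hQ c s a)
  -- Only almost surely: a vanishing true likelihood would make the ratio `0` by the convention for
  -- division.
  refine le_trans (measure_mono_ae ?_) (historyLaw_episodeValue_ge_le M I hloss hdyn hx hw hw1 ht hL)
  filter_upwards [ae_historyLaw_trans_ne_zero M I T] with D hD hmem
  refine ⟨?_, hmem.2⟩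
  have hlik := prod_le_prod_of_logLik_le (fun c s a => (hP c s a).1) (fun c s a => (hQ c s a).1)
    hmem.1
  set D' := Fin.take t ht D with hD'
  have hpos : 0 < ∏ i, ∏ h, M.trans (D' i).1 ((D' i).2 h).1 ((D' i).2 h).2.1
      ((D' i).2 h).2.2.2 :=
    Finset.prod_pos fun i _ => Finset.prod_pos fun h _ =>
      lt_of_le_of_ne ((hQ _ _ _).1 _) (hD (Fin.castLE ht i) h).symm
  have h1 : ∏ i, ∏ h, w ((D' i).1, (D' i).2 h) = ENNReal.ofReal (∏ i, ∏ h,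
      (√(P (D' i).1 ((D' i).2 h).1 ((D' i).2 h).2.1 ((D' i).2 h).2.2.2 /
        M.trans (D' i).1 ((D' i).2 h).1 ((D' i).2 h).2.1 ((D' i).2 h).2.2.2)
      * Real.exp (hel (P (D' i).1 ((D' i).2 h).1 ((D' i).2 h).2.1)
        (M.trans (D' i).1 ((D' i).2 h).1 ((D' i).2 h).2.1) / 2))) := by
    have h0 : ∀ i h, 0 ≤ (√(P (D' i).1 ((D' i).2 h).1 ((D' i).2 h).2.1 ((D' i).2 h).2.2.2 /
        M.trans (D' i).1 ((D' i).2 h).1 ((D' i).2 h).2.1 ((D' i).2 h).2.2.2)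
      * Real.exp (hel (P (D' i).1 ((D' i).2 h).1 ((D' i).2 h).2.1)
        (M.trans (D' i).1 ((D' i).2 h).1 ((D' i).2 h).2.1) / 2)) := fun i h =>
      mul_nonneg (Real.sqrt_nonneg _) (Real.exp_pos _).le
    rw [ENNReal.ofReal_prod_of_nonneg fun i _ => Finset.prod_nonneg fun h _ => h0 i h]
    refine Finset.prod_congr rfl fun i _ => ?_
    rw [ENNReal.ofReal_prod_of_nonneg fun h _ => h0 i h]
  rw [h1]
  refine ENNReal.ofReal_le_ofReal ?_
  simp_rw [Finset.prod_mul_distrib, Real.exp_sum]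
  refine le_mul_of_one_le_left (Finset.prod_nonneg fun i _ => Finset.prod_nonneg fun h _ =>
    (Real.exp_pos _).le) ?_
  have h2 : ∏ i, ∏ h, √(P (D' i).1 ((D' i).2 h).1 ((D' i).2 h).2.1 ((D' i).2 h).2.2.2 /
        M.trans (D' i).1 ((D' i).2 h).1 ((D' i).2 h).2.1 ((D' i).2 h).2.2.2)
      = √((∏ i, ∏ h, P (D' i).1 ((D' i).2 h).1 ((D' i).2 h).2.1 ((D' i).2 h).2.2.2) /
        ∏ i, ∏ h, M.trans (D' i).1 ((D' i).2 h).1 ((D' i).2 h).2.1 ((D' i).2 h).2.2.2) := by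
    have h0 : ∀ i h, 0 ≤ P (D' i).1 ((D' i).2 h).1 ((D' i).2 h).2.1 ((D' i).2 h).2.2.2 /
        M.trans (D' i).1 ((D' i).2 h).1 ((D' i).2 h).2.1 ((D' i).2 h).2.2.2 := fun i h =>
      div_nonneg ((hP _ _ _).1 _) ((hQ _ _ _).1 _)
    simp_rw [← Finset.prod_div_distrib]
    rw [Real.sqrt_prod _ fun i _ => Finset.prod_nonneg fun h _ => h0 i h]
    refine Finset.prod_congr rfl fun i _ => ?_
    rw [Real.sqrt_prod _ fun h _ => h0 i h]
  -- The square-root likelihood ratio is at least one, so the compensators `exp(hel / 2)` alone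
  -- already give the realised score.
  rw [h2, Real.one_le_sqrt, one_le_div hpos]
  exact hlik

/-- A loss function with at most the squared error of the true one on the data of `t` episodes is
close to it in expected squared distance. -/
lemma historyLaw_sqErr_le
    (hloss : ∀ n, Measurable (I.lossOracle n)) (hdyn : ∀ n, Measurable (I.dynOracle n))
    {f : C → S → A → ℝ} (hf : ∀ c s a, f c s a ∈ Set.Icc (0 : ℝ) 1)
    (hℓ : ∀ c s a, M.meanLoss c s a ∈ Set.Icc (0 : ℝ) 1) {t T : ℕ} (ht : t ≤ T) {L : ℝ}
    (hL : 0 < L) :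
    historyLaw M I T {D | sqErr f (Fin.take t ht D) ≤ sqErr M.meanLoss (Fin.take t ht D) ∧
      2 * (H + 1) * Real.log L ≤ ∑ i : Fin t,
        M.episodeValue (policy M I i (Fin.take i i.isLt.le (Fin.take t ht D)))
          fun c s a => (f c s a - M.meanLoss c s a) ^ 2 / 2}
      ≤ ENNReal.ofReal (1 / L) := by
  have hx : ∀ c s a, (f c s a - M.meanLoss c s a) ^ 2 / 2 ∈ Set.Icc (0 : ℝ) 1 := fun c s a => by
    have h1 := hf c s a
    have h2 := hℓ c s a
    constructor
    · positivity
    · nlinarith [h1.1, h1.2, h2.1, h2.2]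
  let w : C × Step S A → ℝ≥0∞ := fun y => ENNReal.ofReal (Real.exp
    (2 * (f y.1 y.2.1 y.2.2.1 - M.meanLoss y.1 y.2.1 y.2.2.1) *
      (y.2.2.2.1 - M.meanLoss y.1 y.2.1 y.2.2.1)
        - (f y.1 y.2.1 y.2.2.1 - M.meanLoss y.1 y.2.1 y.2.2.1) ^ 2 / 2))
  have hw : Measurable w := by
    have h1 : Measurable fun y : C × Step S A => f y.1 y.2.1 y.2.2.1 :=
      measurable_discrete_step fun c s a _ => f c s a
    have h2 : Measurable fun y : C × Step S A => M.meanLoss y.1 y.2.1 y.2.2.1 :=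
      measurable_discrete_step fun c s a _ => M.meanLoss c s a
    have h3 : Measurable fun y : C × Step S A => y.2.2.2.1 := by fun_prop
    exact (((((h1.sub h2).const_mul 2).mul (h3.sub h2)).sub
      (((h1.sub h2).pow_const 2).div_const 2)).exp).ennreal_ofReal
  have hw1 : ∀ c s a, ∑ s', ENNReal.ofReal (M.trans c s a s') *
      ∫⁻ l, w (c, s, a, l, s') ∂M.lossLaw c s a ≤ 1 := fun c s a => by
    have := M.lossLaw_prob c s a
    have h1 := lintegral_exp_hoeffding_le_one (M.lossLaw_supp c s a)
      (f c s a - M.meanLoss c s a)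
    calc _ ≤ ∑ s', ENNReal.ofReal (M.trans c s a s') :=
          Finset.sum_le_sum fun s' _ => mul_le_of_le_one_right' h1
      _ = 1 := by
          rw [← ENNReal.ofReal_sum_of_nonneg fun s' _ => (M.trans_layered.1 c s a).1 s',
            (M.trans_layered.1 c s a).2, ENNReal.ofReal_one]
  refine le_trans (measure_mono fun D hmem => ?_)
    (historyLaw_episodeValue_ge_le M I hloss hdyn hx hw hw1 ht hL)
  refine ⟨?_, hmem.2⟩
  have hsq := hmem.1
  set D' := Fin.take t ht D with hD'
  simp only [w]
  simp_rw [← ENNReal.ofReal_prod_of_nonneg fun _ _ => (Real.exp_pos _).le, ← Real.exp_sum]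
  rw [← ENNReal.ofReal_prod_of_nonneg fun _ _ => (Real.exp_pos _).le, ← Real.exp_sum]
  refine ENNReal.ofReal_le_ofReal (Real.exp_le_exp.2 ?_)
  simp only [sqErr] at hsq
  rw [← sub_nonneg] at hsq ⊢
  simp_rw [← Finset.sum_sub_distrib] at hsq ⊢
  refine hsq.trans_eq (Finset.sum_congr rfl fun i _ => Finset.sum_congr rfl fun h _ => ?_)
  ring

end Estimation

/-! ### Constants, one round, and the union bound. -/

section Assembly

lemma sum_mul_sum_mul_add {C ι : Type*} [Fintype C] [Fintype ι] {p : C → ℝ}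
    (hp : p ∈ stdSimplex ℝ C) (a k₁ k₂ q : ℝ) (u v : C → ι → ℝ) :
    ∑ c, p c * (a + k₁ * ∑ i, 3 * (u c i + q * v c i) + k₂ * ∑ i, 3 * (v c i + q * v c i))
      = a + 3 * k₁ * (∑ i, ∑ c, p c * u c i + q * ∑ i, ∑ c, p c * v c i)
        + 3 * k₂ * ((1 + q) * ∑ i, ∑ c, p c * v c i) := by
  rw [Finset.sum_comm (f := fun i c => p c * u c i), Finset.sum_comm (f := fun i c => p c * v c i)]
  have ha : a = ∑ c, p c * a := by rw [← Finset.sum_mul, hp.2, one_mul]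
  conv_rhs => rw [ha]
  rw [Finset.mul_sum, Finset.mul_sum, ← Finset.sum_add_distrib, Finset.mul_sum, Finset.mul_sum,
    ← Finset.sum_add_distrib, ← Finset.sum_add_distrib]
  refine Finset.sum_congr rfl fun c _ => ?_
  simp_rw [← Finset.mul_sum, Finset.sum_add_distrib, ← Finset.mul_sum]
  ring

/-- The computation gives `12.5 lF + 27 lP` times `H³` over `βl` and `19.75 lP` times `H⁴` over
`βP`; the stated constants leave slack. -/
lemma optimism_bound_arith {H βl βP U V lF lP lFP lP' : ℝ} (hH : 1 ≤ H) (hβl : 0 < βl)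
    (hβP : 0 < βP) (hU : U ≤ 8 * H * lF) (hV : V ≤ 8 * H * lP) (hF : 1 ≤ lF) (hP : 1 ≤ lP)
    (hFP : lF + lP ≤ lFP) (hP' : lP ≤ lP') :
    (H / (2 * βl) + H ^ 2 / (4 * βP)) + 3 * (1 / (2 * βl)) * (U + 9 / 4 * H ^ 2 * V)
        + 3 * (H / (4 * βP)) * ((1 + 9 / 4 * H ^ 2) * V)
      ≤ 112 * H ^ 3 * lFP / βl + 25 * H ^ 4 * lP' / βP := by
  have hH2 : 1 ≤ H ^ 2 := one_le_pow₀ hH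
  have hH0 : 0 < H := by linarith
  have hH3 : H ≤ H ^ 3 := le_self_pow₀ hH (by norm_num)
  have hH23 : H ^ 2 ≤ H ^ 4 := pow_le_pow_right₀ hH (by norm_num)
  have h1 : H / 2 + 3 / 2 * (U + 9 / 4 * H ^ 2 * V) ≤ 112 * H ^ 3 * lFP := by
    have e1 : H ^ 2 * V ≤ H ^ 2 * (8 * H * lP) := mul_le_mul_of_nonneg_left hV (by positivity)
    have e2 : H * lF ≤ H ^ 3 * lF := mul_le_mul_of_nonneg_right hH3 (by linarith)
    have e3 : H ≤ H ^ 3 * lF := hH3.trans (le_mul_of_one_le_right (by positivity) hF)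
    have e4 : H ^ 3 * (lF + lP) ≤ H ^ 3 * lFP := mul_le_mul_of_nonneg_left hFP (by positivity)
    have e5 : 0 ≤ H ^ 3 * lP := by positivity
    have e6 : 0 ≤ H ^ 3 * lF := by positivity
    nlinarith
  have h2 : H ^ 2 / 4 + 3 * H / 4 * ((1 + 9 / 4 * H ^ 2) * V) ≤ 25 * H ^ 4 * lP' := by
    have e1 : H * ((1 + 9 / 4 * H ^ 2) * V) ≤ H * ((1 + 9 / 4 * H ^ 2) * (8 * H * lP)) := by
      gcongr
    have e2 : H ^ 2 * lP ≤ H ^ 4 * lP := mul_le_mul_of_nonneg_right hH23 (by linarith)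
    have e3 : H ^ 2 ≤ H ^ 4 * lP := hH23.trans (le_mul_of_one_le_right (by positivity) hP)
    have e4 : H ^ 4 * lP ≤ H ^ 4 * lP' := mul_le_mul_of_nonneg_left hP' (by positivity)
    have e5 : 0 ≤ H ^ 4 * lP := by positivity
    nlinarith
  calc _ = (H / 2 + 3 / 2 * (U + 9 / 4 * H ^ 2 * V)) / βl
        + (H ^ 2 / 4 + 3 * H / 4 * ((1 + 9 / 4 * H ^ 2) * V)) / βP := by
        field_simp
        ring
    _ ≤ _ := by gcongr

variable {C S A : Type*} [Fintype C] [Fintype S] [Fintype A] {H : ℕ}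

/-- Concentration is proved for halved scores: the Hellinger distance is at most `2`, and the
Hoeffding weight yields half the squared error. -/
lemma CMDP.episodeValue_half (M : CMDP C S A H) (π : C → S → A → ℝ) (x : C → S → A → ℝ) :
    M.episodeValue π x = 2 * M.episodeValue π fun c s a => x c s a / 2 := by
  have h : ∀ c, valRem (π c) (M.trans c) (fun s a => x c s a / 2) H M.start
      = 1 / 2 * valRem (π c) (M.trans c) (x c) H M.start := fun c => by
    rw [← valRem_const_mul]
    congr 1
    funext s a
    ring
  simp only [CMDP.episodeValue, h]
  rw [Finset.mul_sum]
  exact Finset.sum_congr rfl fun c _ => by ring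

variable [Nonempty A] [DecidableEq S]

/-- The optimism term of one round, in terms of the expected estimation errors of the oracles. -/
lemma sum_ctx_mul_optimism_le (hH : 1 ≤ H) (M : CMDP C S A H) (I : Input C S A H)
    (hβl : 0 < I.βl) (hβP : 0 < I.βP) {πstar : C → S → A → ℝ} (hπstar : ∀ c, IsPolicy (πstar c))
    (hℓ : ∀ c s a, M.meanLoss c s a ∈ Set.Icc (0 : ℝ) 1) {n : ℕ} (D : Fin n → Episode C S A H)
    (hf : ∀ c s a, I.lossOracle n D c s a ∈ Set.Icc (0 : ℝ) 1)
    (hP : ∀ c s a, I.dynOracle n D c s a ∈ stdSimplex ℝ S) :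
    ∑ c, M.ctx c * ∑ h ∈ Finset.range H, expect M.start (πstar c) (M.trans c) h (fun s a =>
        Qhat M I D c h s a - M.meanLoss c s a - ∑ s', M.trans c s a s' * Vhat M I D c (h + 1) s')
      ≤ (H / (2 * I.βl) + (H : ℝ) ^ 2 / (4 * I.βP))
        + 3 * (1 / (2 * I.βl)) * (∑ i : Fin n, M.episodeValue
            (policy M I i (Fin.take i i.isLt.le D))
            (fun c s a => (I.lossOracle n D c s a - M.meanLoss c s a) ^ 2)
          + 9 / 4 * (H : ℝ) ^ 2 * ∑ i : Fin n, M.episodeValue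
            (policy M I i (Fin.take i i.isLt.le D))
            (fun c s a => hel (I.dynOracle n D c s a) (M.trans c s a)))
        + 3 * (H / (4 * I.βP)) * ((1 + 9 / 4 * (H : ℝ) ^ 2) * ∑ i : Fin n, M.episodeValue
            (policy M I i (Fin.take i i.isLt.le D))
            (fun c s a => hel (I.dynOracle n D c s a) (M.trans c s a))) := by
  simp only [CMDP.episodeValue]
  rw [← sum_mul_sum_mul_add M.ctx_mem]
  refine Finset.sum_le_sum fun c _ => mul_le_mul_of_nonneg_left ?_ (M.ctx_mem.1 c)
  exact sum_expect_optimistic_step_le hH M (M.trans_layered.1 c) (M.trans_layered.2 c) (hP c)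
    (isPolicy_policy M I n D c) (hπstar c)
    (fun i : Fin n => isPolicy_policy M I i (Fin.take i i.isLt.le D) c) (hf c) (hℓ c) hβl hβP rfl

variable [MeasurableSpace C] [MeasurableSpace S] [MeasurableSpace A]
  [DiscreteMeasurableSpace C] [DiscreteMeasurableSpace S] [DiscreteMeasurableSpace A]

/-- With high probability, all the estimates of both oracles are accurate in expectation over the
episodes from which they were computed. -/
lemma historyLaw_estimation_error_ge_le (M : CMDP C S A H) (I : Input C S A H)
    {F : Finset (C → S → A → ℝ)} (hF : ∀ f ∈ F, ∀ c s a, f c s a ∈ Set.Icc (0 : ℝ) 1)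
    (hFreal : M.meanLoss ∈ F)
    {FP : Finset (C → S → A → S → ℝ)} (hFP : ∀ P ∈ FP, ∀ c s a, P c s a ∈ stdSimplex ℝ S)
    (hFPreal : M.trans ∈ FP)
    (hloss : IsLeastSquaresOracle F I.lossOracle) (hloss_meas : ∀ n, Measurable (I.lossOracle n))
    (hdyn : IsLogLossOracle FP I.dynOracle) (hdyn_meas : ∀ n, Measurable (I.dynOracle n))
    (T : ℕ) {LF LP : ℝ} (hLF : 0 < LF) (hLP : 0 < LP) :
    historyLaw M I T {D | ¬ ∀ t : Fin T,
      (∑ i : Fin t, M.episodeValue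
        (policy M I i (Fin.take i i.isLt.le (Fin.take t t.isLt.le D))) (fun c s a =>
          (I.lossOracle t (Fin.take t t.isLt.le D) c s a - M.meanLoss c s a) ^ 2)
        ≤ 4 * (H + 1) * Real.log LF) ∧
      (∑ i : Fin t, M.episodeValue
        (policy M I i (Fin.take i i.isLt.le (Fin.take t t.isLt.le D))) (fun c s a =>
          hel (I.dynOracle t (Fin.take t t.isLt.le D) c s a) (M.trans c s a))
        ≤ 4 * (H + 1) * Real.log LP)}
      ≤ ENNReal.ofReal (T * (F.card / LF + FP.card / LP)) := by
  -- Failure events for fixed candidates. The oracle output depends on the data, but it always lies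
  -- in the class and fits at least as well as the truth, so a failure at round `t` lies in one of
  -- these events.
  let B₁ : Fin T → (C → S → A → ℝ) → Set (Fin T → Episode C S A H) := fun t f =>
    {D | sqErr f (Fin.take t t.isLt.le D) ≤ sqErr M.meanLoss (Fin.take t t.isLt.le D) ∧
      2 * (H + 1) * Real.log LF ≤ ∑ i : Fin t,
        M.episodeValue (policy M I i (Fin.take i i.isLt.le (Fin.take t t.isLt.le D)))
          fun c s a => (f c s a - M.meanLoss c s a) ^ 2 / 2}
  let B₂ : Fin T → (C → S → A → S → ℝ) → Set (Fin T → Episode C S A H) := fun t P =>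
    {D | logLik M.trans (Fin.take t t.isLt.le D) ≤ logLik P (Fin.take t t.isLt.le D) ∧
      2 * (H + 1) * Real.log LP ≤ ∑ i : Fin t,
        M.episodeValue (policy M I i (Fin.take i i.isLt.le (Fin.take t t.isLt.le D)))
          fun c s a => hel (P c s a) (M.trans c s a) / 2}
  have h1 : ∀ t, ∀ f ∈ F, historyLaw M I T (B₁ t f) ≤ ENNReal.ofReal (1 / LF) := fun t f hf =>
    historyLaw_sqErr_le M I hloss_meas hdyn_meas (hF f hf) (hF _ hFreal) t.isLt.le hLF
  have h2 : ∀ t, ∀ P ∈ FP, historyLaw M I T (B₂ t P) ≤ ENNReal.ofReal (1 / LP) := fun t P hP =>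
    historyLaw_logLik_le M I hloss_meas hdyn_meas (hFP P hP) t.isLt.le hLP
  calc _ ≤ historyLaw M I T (⋃ t : Fin T, (⋃ f ∈ F, B₁ t f) ∪ ⋃ P ∈ FP, B₂ t P) := by
        refine measure_mono fun D hD => ?_
        rw [Set.mem_ofPred_eq] at hD
        push Not at hD
        obtain ⟨t, ht⟩ := hD
        refine Set.mem_iUnion.2 ⟨t, ?_⟩
        obtain ⟨hfF, hfmin⟩ := hloss t (Fin.take t t.isLt.le D)
        obtain ⟨hPF, hPmax⟩ := hdyn t (Fin.take t t.isLt.le D)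
        simp_rw [CMDP.episodeValue_half M _ (fun c s a =>
          (I.lossOracle t (Fin.take t t.isLt.le D) c s a - M.meanLoss c s a) ^ 2),
          CMDP.episodeValue_half M _ (fun c s a =>
          hel (I.dynOracle t (Fin.take t t.isLt.le D) c s a) (M.trans c s a)),
          ← Finset.mul_sum] at ht
        by_cases hl : 2 * (H + 1) * Real.log LF ≤ ∑ i : Fin t,
          M.episodeValue (policy M I i (Fin.take i i.isLt.le (Fin.take t t.isLt.le D)))
            fun c s a => (I.lossOracle t (Fin.take t t.isLt.le D) c s a
              - M.meanLoss c s a) ^ 2 / 2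
        · exact Or.inl (Set.mem_biUnion hfF ⟨hfmin _ hFreal, hl⟩)
        · have h3 := ht (by linarith)
          exact Or.inr (Set.mem_biUnion hPF ⟨hPmax _ hFPreal, by linarith⟩)
    _ ≤ ∑ _t : Fin T, (∑ _f ∈ F, ENNReal.ofReal (1 / LF) + ∑ _P ∈ FP, ENNReal.ofReal (1 / LP)) := by
        refine (measure_iUnion_fintype_le _ _).trans (Finset.sum_le_sum fun t _ => ?_)
        refine (measure_union_le _ _).trans (add_le_add ?_ ?_)
        · exact (measure_biUnion_finset_le _ _).trans (Finset.sum_le_sum (h1 t))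
        · exact (measure_biUnion_finset_le _ _).trans (Finset.sum_le_sum (h2 t))
    _ = _ := by
        simp only [Finset.sum_const, nsmul_eq_mul, Finset.card_univ, Fintype.card_fin]
        rw [ENNReal.ofReal_mul (by positivity), ENNReal.ofReal_add (by positivity) (by positivity),
          div_eq_mul_one_div (F.card : ℝ), div_eq_mul_one_div (FP.card : ℝ),
          ENNReal.ofReal_mul (by positivity), ENNReal.ofReal_mul (by positivity)]
        simp

end Assembly

end OPO

end

/-! ### The main bound. -/

theorem lemma4 {C S A : Type*} [Fintype C] [Fintype S] [Fintype A] [Nonempty A] [DecidableEq S]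
    [MeasurableSpace C] [MeasurableSpace S] [MeasurableSpace A]
    [DiscreteMeasurableSpace C] [DiscreteMeasurableSpace S] [DiscreteMeasurableSpace A]
    {H : ℕ} (hH : 1 ≤ H) (M : OPO.CMDP C S A H)
    (F : Finset (C → S → A → ℝ)) (hF : ∀ f ∈ F, ∀ c s a, f c s a ∈ Set.Icc (0 : ℝ) 1)
    (hFreal : M.meanLoss ∈ F)
    (FP : Finset (C → S → A → S → ℝ)) (hFP : ∀ P ∈ FP, OPO.IsLayeredDynamics H M.layer P)
    (hFPreal : M.trans ∈ FP)
    (I : OPO.Input C S A H) (hβl : 0 < I.βl) (hβP : 0 < I.βP)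
    (hloss : OPO.IsLeastSquaresOracle F I.lossOracle)
    (hloss_meas : ∀ n, Measurable (I.lossOracle n))
    (hdyn : OPO.IsLogLossOracle FP I.dynOracle)
    (hdyn_meas : ∀ n, Measurable (I.dynOracle n))
    (πstar : C → S → A → ℝ) (hπstar : M.IsOptimal πstar)
    {T : ℕ} (hT : 1 ≤ T) {δ : ℝ} (hδ0 : 0 < δ) (hδ1 : δ < 1) :
    ENNReal.ofReal (1 - δ / 4) ≤
      OPO.historyLaw M I T {D | OPO.optimismTerm M I πstar D ≤
        (H : ℝ) * (H + 1)
          + 112 * T * (H : ℝ) ^ 3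
              * Real.log (128 * (T : ℝ) ^ 4 * H * F.card * FP.card / δ ^ 2) / I.βl
          + 25 * T * (H : ℝ) ^ 4 * Real.log (8 * T * H * FP.card / δ) / I.βP} := by
  have hH' : (1 : ℝ) ≤ H := by exact_mod_cast hH
  have hT' : (1 : ℝ) ≤ T := by exact_mod_cast hT
  have hFc : (1 : ℝ) ≤ F.card := by exact_mod_cast Finset.card_pos.2 ⟨_, hFreal⟩
  have hFPc : (1 : ℝ) ≤ FP.card := by exact_mod_cast Finset.card_pos.2 ⟨_, hFPreal⟩
  have hlog : ∀ r : ℝ, 1 ≤ r → 1 ≤ Real.log (8 * T * r / δ) := fun r hr => by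
    rw [Real.le_log_iff_exp_le (by positivity), le_div_iff₀ hδ0]
    have h1 : 1 ≤ T * r := one_le_mul_of_one_le_of_one_le hT' hr
    have h2 := mul_le_mul_of_nonneg_left hδ1.le (Real.exp_pos 1).le
    linarith [Real.exp_one_lt_d9]
  -- Chosen so that each of the two union bounds over rounds and candidates costs `δ / 8`.
  set LF : ℝ := 8 * T * F.card / δ with hLF
  set LP : ℝ := 8 * T * FP.card / δ with hLP
  have hLF0 : 0 < LF := by positivity
  have hLP0 : 0 < LP := by positivity
  have hLFlog : 1 ≤ Real.log LF := hlog _ hFc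
  have hLPlog : 1 ≤ Real.log LP := hlog _ hFPc
  have hP' : Real.log LP ≤ Real.log (8 * T * H * FP.card / δ) := by
    refine Real.log_le_log hLP0 ?_
    exact div_le_div_of_nonneg_right (mul_le_mul_of_nonneg_right
      (le_mul_of_one_le_right (by positivity) hH') (by positivity)) hδ0.le
  have hFP' : Real.log LF + Real.log LP
      ≤ Real.log (128 * (T : ℝ) ^ 4 * H * F.card * FP.card / δ ^ 2) := by
    rw [← Real.log_mul hLF0.ne' hLP0.ne']
    refine Real.log_le_log (by positivity) ?_
    have h1 : LF * LP = 64 * (T : ℝ) ^ 2 * 1 * F.card * FP.card / δ ^ 2 := by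
      rw [hLF, hLP]
      field_simp
      ring
    rw [h1]
    have h2 : (T : ℝ) ^ 2 ≤ T ^ 4 := pow_le_pow_right₀ hT' (by norm_num)
    gcongr
    norm_num
  have hbad := OPO.historyLaw_estimation_error_ge_le M I hF hFreal (fun P hP => (hFP P hP).1)
    hFPreal hloss hloss_meas hdyn hdyn_meas T hLF0 hLP0
  have hδ : (T : ℝ) * (F.card / LF + FP.card / LP) = δ / 4 := by
    rw [hLF, hLP]
    field_simp
    norm_num
  rw [hδ] at hbad
  have hprob := OPO.isProbabilityMeasure_historyLaw M I hloss_meas hdyn_meas T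
  rw [ENNReal.ofReal_sub _ (by positivity), ENNReal.ofReal_one]
  refine tsub_le_iff_right.2 ?_
  rw [← measure_univ (μ := OPO.historyLaw M I T)]
  -- Covering the whole space by the two events avoids proving either of them measurable.
  refine le_trans (le_trans (measure_mono fun D _ => ?_) (measure_union_le _ _))
    (add_le_add_right hbad _)
  rw [Set.mem_union, or_iff_not_imp_right, Set.mem_ofPred_eq, Set.mem_ofPred_eq, not_not]
  intro hgood
  have hround : ∀ t : Fin T, _ ≤ 112 * (H : ℝ) ^ 3
      * Real.log (128 * (T : ℝ) ^ 4 * H * F.card * FP.card / δ ^ 2) / I.βl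
      + 25 * (H : ℝ) ^ 4 * Real.log (8 * T * H * FP.card / δ) / I.βP := fun t =>
    (OPO.sum_ctx_mul_optimism_le hH M I hβl hβP (fun c => (hπstar c).1) (hF _ hFreal)
      (Fin.take t t.isLt.le D) (hF _ (hloss t _).1) (hFP _ (hdyn t _).1).1).trans
    (OPO.optimism_bound_arith hH' hβl hβP
      -- `4(H + 1) ≤ 8H` because `H ≥ 1`.
      ((hgood t).1.trans (mul_le_mul_of_nonneg_right (by linarith) (by linarith)))
      ((hgood t).2.trans (mul_le_mul_of_nonneg_right (by linarith) (by linarith)))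
      hLFlog hLPlog hFP' hP')
  have hsum := Finset.sum_le_sum fun t (_ : t ∈ Finset.univ) => hround t
  refine hsum.trans ?_
  rw [Finset.sum_const, Finset.card_univ, Fintype.card_fin, nsmul_eq_mul]
  -- The additive `H(H + 1)` of the claim is pure slack.
  have h0 : 0 ≤ (H : ℝ) * (H + 1) := by positivity
  refine le_trans (le_of_eq ?_) (add_le_add_left (le_add_of_nonneg_left h0) _)
  ring
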